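/- Notation. For $F:\mathbb R\to\mathbb R$ and $M>0$ let $\|f\|_{\infty,[-M,M]}=\sup_{|x|\le M}|f(x)|$. For a real number $K\ge 0$ let $\delta_{K,M}=\min_{P}\|F-P\|_{\infty,[-M,M]}$, the minimum being over real polynomials $P$ of degree at most $K$; let $P_{K,M}=\sum_{0\le k\le K}a_{k,K,M}X^k$ be a minimizer (any one, if it is not unique). Let $H_k(x)=(-1)^k e^{x^2/2}\frac{d^k}{dx^k}e^{-x^2/2}$ be the Hermite polynomials. Let $d\ge 1$ be an integer and $2\sqrt d\le s\le d$. The observations are independent random variables $y_{1,i},y_{2,i}$, $i=1,\dots,d$ (a duplicated sample), with $y_{1,i},y_{2,i}\sim\mathcal N(\theta_i,1)$, where $\theta\in\mathbb R^d$ is unknown; $\mathbf E_\theta$ denotes the corresponding expectation. Let $\Theta_{s,M}$ be the set of $\theta\in\mathbb R^d$ with at most $s$ nonzero coordinates and with $\max_i|\theta_i|\le M$. The quantity to estimate is $\mathbf F(\theta)=\sum_{i=1}^d F(\theta_i)$. For positive numbers $\epsilon_1,C_1,\epsilon_2,C_2$ consider the assumptions $$\textbf{(A1)}\quad \sup_{\sqrt{2\log(s^2/d)}\le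 M\le\sqrt{2\log d}}\frac{\|F-F(0)\|_{\infty,[-M,M]}}{e^{\epsilon_1M^2}}\le C_1,\qquad \textbf{(A2)}\quad \sup_{\sqrt{2\log(s^2/d)}\le M\le\sqrt{2\log d}}\frac{\delta_{M^2,M}^{-1}}{e^{\epsilon_2M^2}}\le C_2$$ (in (A2), $0^{-1}=+\infty$). For $c>0$ let $L\ge -1$ be the largest integer such that $2^L<\sqrt{\log(d)/\log(s^2/d)}$. Put $M_l=2^l\sqrt{2\log(s^2/d)}$ for $0\le l\le L$ and $M_{L+1}=\sqrt{2\log d}$; put $K_l=\frac c8M_l^2$ for $0\le l\le L+1$, $t_{-1}=0$ and $t_l=M_l/2$ for $0\le l\le L$. Define $\hat P_{K,M}(u)=\sum_{1\le k\le K}a_{k,K,M}H_k(u)$, $$\hat F(u,v)=\sum_{l=0}^{L}\hat P_{K_l,M_l}(u)\mathbf 1_{t_{l-1}<|v|\le t_l}+\hat P_{K_{L+1},M_{L+1}}(u)\mathbf 1_{t_L<|v|},$$ and the estimator $\hat{\mathbf F}=d\,F(0)+\sum_{i=1}^d\hat F(y_{1,i},y_{2,i})$ (when $F(0)=0$ the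 first term vanishes). Theorem. There are an absolute constant $\eta>0$, positive numbers $c_0(\epsilon_1,\epsilon_2)$ depending only on $\epsilon_1,\epsilon_2$, and positive numbers $C_3=C_3(C_1,C_2)$ depending only on $C_1,C_2$, such that the following holds. If $\epsilon_1+\epsilon_2<\eta$, $0<c\le c_0(\epsilon_1,\epsilon_2)$, $2\sqrt d\le s\le d$, and $F$ satisfies (A1) and (A2), then $$\sup_{\theta\in\Theta_{s,\sqrt{2\log d}}}\mathbf E_\theta\big(\hat{\mathbf F}-\mathbf F(\theta)\big)^2\le C_3\,s^2\max_{l=0,\dots,L+1}\delta_{K_l,M_l}^2.$$ -/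

import Mathlib

open Real MeasureTheory ProbabilityTheory Polynomial
open scoped ENNReal

namespace AdditiveFunctional

noncomputable section

/-- The sup-norm of `f` on `[-M, M]`, valued in `[0, ∞]` (it is `∞` if `f` is unbounded there). -/
def supNorm (M : ℝ) (f : ℝ → ℝ) : ℝ≥0∞ :=
  ⨆ x ∈ Set.Icc (-M) M, ‖f x‖ₑ

/-- The polynomial approximation rate `δ_{K,M}` of `F`: the distance in sup-norm on `[-M, M]` from
`F` to the real polynomials of degree at most the real number `K`. -/
def approxRate (F : ℝ → ℝ) (K M : ℝ) : ℝ≥0∞ :=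
  ⨅ (P : ℝ[X]) (_ : (P.natDegree : ℝ) ≤ K), supNorm M (fun x => F x - P.eval x)

/-- `P` is a best approximation `P_{K,M}` of `F` on `[-M, M]` among the polynomials of degree at
most `K`. -/
def IsBestApprox (F : ℝ → ℝ) (K M : ℝ) (P : ℝ[X]) : Prop :=
  (P.natDegree : ℝ) ≤ K ∧ supNorm M (fun x => F x - P.eval x) = approxRate F K M

/-- The growth assumption on `F`, with constants `ε₁, C₁`. -/
def AssumptionA1 (F : ℝ → ℝ) (d : ℕ) (s ε₁ C₁ : ℝ) : Prop :=
  (⨆ M ∈ Set.Icc (√(2 * log (s ^ 2 / d))) (√(2 * log d)),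
    supNorm M (fun x => F x - F 0) / ENNReal.ofReal (exp (ε₁ * M ^ 2))) ≤ ENNReal.ofReal C₁

/-- The assumption that `F` is not too well approximated by polynomials, with constants `ε₂, C₂`.
The inverse is that of `[0, ∞]`, so that a vanishing approximation rate is excluded. -/
def AssumptionA2 (F : ℝ → ℝ) (d : ℕ) (s ε₂ C₂ : ℝ) : Prop :=
  (⨆ M ∈ Set.Icc (√(2 * log (s ^ 2 / d))) (√(2 * log d)),
    (approxRate F (M ^ 2) M)⁻¹ / ENNReal.ofReal (exp (ε₂ * M ^ 2))) ≤ ENNReal.ofReal C₂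

/-- `L`, the largest integer such that `2 ^ L < √(log d / log (s² / d))`; it is `-1` if `s = d`. -/
def topLevel (d : ℕ) (s : ℝ) : ℤ :=
  sSup {L : ℤ | (2 : ℝ) ^ L < √(log d / log (s ^ 2 / d))}

/-- `L + 1`, the index of the last scale. -/
def lastIndex (d : ℕ) (s : ℝ) : ℕ := (topLevel d s + 1).toNat

/-- The scales: `M_l = 2 ^ l √(2 log (s² / d))` for `l ≤ L` and `M_{L+1} = √(2 log d)`. -/
def scale (d : ℕ) (s : ℝ) (l : ℕ) : ℝ :=
  if l < lastIndex d s then 2 ^ l * √(2 * log (s ^ 2 / d)) else √(2 * log d)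

/-- The degrees `K_l = (c / 8) M_l²`. -/
def deg (c : ℝ) (d : ℕ) (s : ℝ) (l : ℕ) : ℝ := c / 8 * scale d s l ^ 2

/-- The upper threshold `t_l = M_l / 2`. -/
def threshold (d : ℕ) (s : ℝ) (l : ℕ) : ℝ := scale d s l / 2

/-- The lower threshold `t_{l-1}`, where `t_{-1} = 0`. -/
def prevThreshold (d : ℕ) (s : ℝ) : ℕ → ℝ
  | 0 => 0
  | l + 1 => threshold d s l

/-- `∑_{k=1}^K a_k H_k(u)`, where the `a_k` are the coefficients of `P`, and the `H_k` are the
(probabilists') Hermite polynomials. -/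
def hermiteEstimate (K : ℝ) (P : ℝ[X]) (u : ℝ) : ℝ :=
  ∑ k ∈ Finset.Icc 1 ⌊K⌋₊, P.coeff k * aeval u (hermite k)

/-- The estimator `F̂(u, v)` of one coordinate's contribution, with `P l` in the role of
`P_{K_l, M_l}`. -/
def coordEstimator (c : ℝ) (d : ℕ) (s : ℝ) (P : ℕ → ℝ[X]) (u v : ℝ) : ℝ :=
  (∑ l ∈ Finset.range (lastIndex d s),
    if prevThreshold d s l < |v| ∧ |v| ≤ threshold d s l then
      hermiteEstimate (deg c d s l) (P l) u else 0) +
  if prevThreshold d s (lastIndex d s) < |v| then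
    hermiteEstimate (deg c d s (lastIndex d s)) (P (lastIndex d s)) u else 0

/-- The estimator `d F(0) + ∑ i, F̂(y_{1,i}, y_{2,i})`. -/
def estimator (F : ℝ → ℝ) (c : ℝ) {d : ℕ} (s : ℝ) (P : ℕ → ℝ[X])
    (y : (Fin d → ℝ) × (Fin d → ℝ)) : ℝ :=
  d * F 0 + ∑ i, coordEstimator c d s P (y.1 i) (y.2 i)

/-- The law of the duplicated sample: all `y_{1,i}, y_{2,i}` are independent, and `y_{1,i}`,
`y_{2,i}` have law `N(θ_i, 1)`. -/
def sampleLaw {d : ℕ} (θ : Fin d → ℝ) : Measure ((Fin d → ℝ) × (Fin d → ℝ)) :=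
  (Measure.pi fun i => gaussianReal (θ i) 1).prod (Measure.pi fun i => gaussianReal (θ i) 1)

/-- The parameter set `Θ_{s,M}`: at most `s` nonzero coordinates, all in `[-M, M]`. -/
def paramSet (d : ℕ) (s M : ℝ) : Set (Fin d → ℝ) :=
  {θ | (hammingNorm θ : ℝ) ≤ s ∧ ∀ i, |θ i| ≤ M}

/-- The quadratic risk at `θ` of an estimator `T` of `∑ i, F (θ i)`. -/
def quadRisk (F : ℝ → ℝ) {d : ℕ} (T : (Fin d → ℝ) × (Fin d → ℝ) → ℝ) (θ : Fin d → ℝ) : ℝ≥0∞ :=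
  ∫⁻ y, ENNReal.ofReal ((T y - ∑ i, F (θ i)) ^ 2) ∂(sampleLaw θ)

/-- For `2√d ≤ s ≤ d`, the largest integer `L` exists and is at least `-1`. -/
theorem topLevel_spec {d : ℕ} {s : ℝ} (hd : 1 ≤ d) (hs : 2 * √d ≤ s) (hsd : s ≤ d) :
    IsGreatest {L : ℤ | (2 : ℝ) ^ L < √(log d / log (s ^ 2 / d))} (topLevel d s) ∧
      -1 ≤ topLevel d s := by
  have hd0 : (0 : ℝ) < d := by exact_mod_cast hd
  have h4 : 4 ≤ s ^ 2 / d := by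
    rw [le_div_iff₀ hd0]
    have := Real.sq_sqrt hd0.le
    nlinarith [Real.sqrt_nonneg (d : ℝ)]
  have hle : s ^ 2 / d ≤ d := by
    rw [div_le_iff₀ hd0]
    nlinarith [Real.sqrt_nonneg (d : ℝ)]
  have hlog : 0 < log (s ^ 2 / d) := Real.log_pos (by linarith)
  have hr : 1 ≤ √(log d / log (s ^ 2 / d)) := by
    rw [Real.one_le_sqrt, one_le_div hlog]
    exact Real.log_le_log (by linarith) hle
  set r := √(log d / log (s ^ 2 / d)) with hrdef
  have hmem : (-1 : ℤ) ∈ {L : ℤ | (2 : ℝ) ^ L < r} := by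
    simp only [Set.mem_ofPred_eq, zpow_neg, zpow_one]
    norm_num
    linarith
  have hbdd : BddAbove {L : ℤ | (2 : ℝ) ^ L < r} := by
    obtain ⟨n, hn⟩ := pow_unbounded_of_one_lt r (one_lt_two : (1 : ℝ) < 2)
    refine ⟨n, fun L hL => ?_⟩
    have h : (2 : ℝ) ^ L < 2 ^ (n : ℤ) := lt_trans hL (by simpa using hn)
    exact ((zpow_lt_zpow_iff_right₀ one_lt_two).1 h).le
  refine ⟨⟨Int.csSup_mem ⟨_, hmem⟩ hbdd, fun L hL => le_csSup hbdd hL⟩, le_csSup hbdd hmem⟩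

/-- A function that is bounded on `[-M, M]` has a best polynomial approximation there. -/
theorem exists_isBestApprox {F : ℝ → ℝ} {K M : ℝ} (hK : 0 ≤ K) (hM : 0 < M)
    (hF : supNorm M F ≠ ∞) : ∃ P, IsBestApprox F K M P := by
  set n := ⌊K⌋₊
  let v : Fin (n + 1) → ℝ := fun j => M * (j / (n + 1))
  have hn : (0 : ℝ) < n + 1 := by positivity
  have hv : Function.Injective v := by
    intro i j hij
    have h1 : (i : ℝ) / (n + 1) = j / (n + 1) := mul_left_cancel₀ hM.ne' hij
    have h2 : ((i : ℕ) : ℝ) = (j : ℕ) := by field_simp at h1; exact h1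
    exact Fin.ext (by exact_mod_cast h2)
  have hvm : ∀ j, v j ∈ Set.Icc (-M) M := by
    intro j
    have h0 : (0 : ℝ) ≤ (j : ℝ) / (n + 1) := by positivity
    have h1 : (j : ℝ) / (n + 1) ≤ 1 := by
      rw [div_le_one hn]
      have := j.2.le
      exact_mod_cast this
    constructor <;> simp only [v] <;> nlinarith
  let I := Lagrange.interpolate (Finset.univ : Finset (Fin (n + 1))) v
  let g : (Fin (n + 1) → ℝ) → ℝ≥0∞ := fun r => supNorm M (fun x => F x - (I r).eval x)
  have hcont : ∀ x, Continuous fun r : Fin (n + 1) → ℝ => (I r).eval x := by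
    intro x
    have := ((Polynomial.leval x).comp I).continuous_of_finiteDimensional
    exact this
  have hg : LowerSemicontinuous g := by
    refine lowerSemicontinuous_iSup fun x => lowerSemicontinuous_iSup fun _ => ?_
    have := hcont x
    exact Continuous.lowerSemicontinuous (by fun_prop)
  set B := (supNorm M F).toReal
  have hB : 0 ≤ B := ENNReal.toReal_nonneg
  obtain ⟨r₀, -, hr₀⟩ := (hg.lowerSemicontinuousOn (Metric.closedBall 0 (2 * B))).exists_isMinOn
    ⟨0, by simpa using hB⟩ (isCompact_closedBall (0 : Fin (n + 1) → ℝ) (2 * B))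
  have hdegI : (((I r₀).natDegree : ℕ) : ℝ) ≤ K := by
    have h := Lagrange.degree_interpolate_lt (s := Finset.univ) r₀ hv.injOn
    rw [Finset.card_univ, Fintype.card_fin] at h
    have h2 : (I r₀).natDegree ≤ n := by
      refine natDegree_le_iff_degree_le.2 (Order.le_of_lt_succ ?_)
      exact h
    exact (Nat.cast_le.2 h2).trans (Nat.floor_le hK)
  refine ⟨I r₀, hdegI, le_antisymm ?_ (iInf₂_le
    (f := fun (P : ℝ[X]) (_ : (P.natDegree : ℝ) ≤ K) => supNorm M (fun x => F x - P.eval x))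
    (I r₀) hdegI)⟩
  refine le_iInf₂ fun P hP => ?_
  have hPn : P.natDegree ≤ n := Nat.le_floor hP
  have hPI : P = I fun j => P.eval (v j) := by
    refine Lagrange.eq_interpolate_of_eval_eq _ hv.injOn ?_ fun _ _ => rfl
    rw [Finset.card_univ, Fintype.card_fin]
    exact (natDegree_le_iff_degree_le.1 hPn).trans_lt (by exact_mod_cast Nat.lt_succ_self n)
  by_cases hr : (fun j => P.eval (v j)) ∈ Metric.closedBall (0 : Fin (n + 1) → ℝ) (2 * B)
  · have h : g r₀ ≤ g fun j => P.eval (v j) := hr₀ hr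
    simpa only [g, ← hPI] using h
  · have h0 : g r₀ ≤ g 0 := hr₀ (by simpa using hB)
    have h1 : g 0 = ENNReal.ofReal B := by
      simp [g, B, ENNReal.ofReal_toReal hF]
    obtain ⟨j, hj⟩ : ∃ j, 2 * B < |P.eval (v j)| := by
      by_contra! hc
      exact hr (by
        rw [mem_closedBall_zero_iff, pi_norm_le_iff_of_nonneg (by positivity)]
        exact hc)
    have h2 : |F (v j)| ≤ B := by
      have : ‖F (v j)‖ₑ ≤ supNorm M F := le_iSup₂_of_le (v j) (hvm j) le_rfl
      simpa using ENNReal.toReal_mono hF this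
    have h3 : B ≤ |F (v j) - P.eval (v j)| := by
      have := abs_sub_abs_le_abs_sub (P.eval (v j)) (F (v j))
      rw [abs_sub_comm] at this
      linarith
    calc g r₀ ≤ ENNReal.ofReal B := h1 ▸ h0
      _ ≤ ‖F (v j) - P.eval (v j)‖ₑ := by
        rw [Real.enorm_eq_ofReal_abs]
        exact ENNReal.ofReal_le_ofReal h3
      _ ≤ supNorm M (fun x => F x - P.eval x) :=
        le_iSup₂_of_le (f := fun x _ => ‖F x - P.eval x‖ₑ) (v j) (hvm j) le_rfl

end

end AdditiveFunctional

open AdditiveFunctional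

/-! Pairing the two samples by coordinate gives `d` independent errors, so the risk is the sum of
their variances plus the square of the sum of their biases. Since `H_k(u)` is unbiased for `θ^k`,
level `l` alone has mean `P_l(θ) - P_l(0)`, which vanishes at `θ = 0`; hence at most `s` coordinates
are biased.

Variance. Lagrange interpolation gives `|a_k| M^k ≤ B e^{4K}` for `k ≥ 1`, the Hermite recurrence
gives `|H_k(x)| ≤ (|x| + √K)^k`, and `K = cM²/8`. (A1) bounds `B`, and (A2), read as `1 ≤ C₂
e^{ε₂M²} δ`, turns this into a bound proportional to `δ`: the second moment is `(κδ)²` times an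
exponential with a small rate (`integral_hermiteEstimate_sq_le_approxRate`). A zero coordinate
reaches level `l ≥ 1` with probability at most `2e^{-M_l²/32}`, which beats that exponential; at
level `0` the exponential is at most `s²/d`, because `M_0² = 2 log(s²/d)`. So `d` such coordinates
cost `O(s²δ²)`. A nonzero coordinate costs `O(√d δ²)`, and `s√d ≤ s²/2`.

Bias. If `|θ| ≤ M_l`, level `l` errs by at most `2δ`. If `M_l < |θ|`, selecting level `l` forces `v`
to deviate from `θ` by at least `|θ|/2`; the probability `2e^{-θ²/8}` absorbs the growth of `P_l`
and `F` beyond `M_l`. Because the scales double, sums over levels are bounded independently of `L`,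
and no logarithmic factor is lost. -/

namespace AdditiveFunctional

/-! ### Coefficients of polynomials bounded on an interval -/

theorem abs_sub_le_abs_add_abs (a b : ℝ) : |a - b| ≤ |a| + |b| := by
  simpa using norm_sub_le a b

theorem abs_coeff_prod_X_sub_C_le {ι : Type*} (S : Finset ι) (v : ι → ℝ)
    (hv : ∀ i ∈ S, |v i| ≤ 1) (k : ℕ) :
    |(∏ i ∈ S, (X - C (v i))).coeff k| ≤ 2 ^ S.card := by
  classical
  induction S using Finset.induction_on generalizing k with
  | empty =>
    rw [Finset.prod_empty, coeff_one]
    split_ifs <;> simp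
  | insert i S hi ih =>
    have ih := ih fun j hj => hv j (Finset.mem_insert_of_mem hj)
    have hi1 := hv i (Finset.mem_insert_self i S)
    rw [Finset.prod_insert hi, Finset.card_insert_of_notMem hi, sub_mul, coeff_sub, coeff_C_mul]
    have h1 : |(X * ∏ j ∈ S, (X - C (v j))).coeff k| ≤ 2 ^ S.card := by
      cases k with
      | zero => simp
      | succ k => rw [coeff_X_mul]; exact ih k
    have h2 : |v i * (∏ j ∈ S, (X - C (v j))).coeff k| ≤ 2 ^ S.card := by
      rw [abs_mul]
      calc _ ≤ 1 * 2 ^ S.card := mul_le_mul hi1 (ih k) (abs_nonneg _) zero_le_one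
        _ = _ := one_mul _
    calc _ ≤ _ := abs_sub_le_abs_add_abs _ _
      _ ≤ 2 ^ (S.card + 1) := by rw [pow_succ, mul_two]; exact add_le_add h1 h2

/-- Up to a power of `n`, these are the Lagrange denominators at equispaced nodes; the nodes on
either side of `j` give one factorial each. -/
theorem prod_erase_range_abs_sub {n j : ℕ} (hj : j ≤ n) :
    ∏ i ∈ (Finset.range (n + 1)).erase j, |(j : ℝ) - i| = j.factorial * (n - j).factorial := by
  have hsplit : (Finset.range (n + 1)).erase j =
      Finset.range j ∪ (Finset.range (n - j)).image (fun i => j + 1 + i) := by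
    ext i
    simp only [Finset.mem_erase, Finset.mem_range, Finset.mem_union, Finset.mem_image]
    constructor
    · rintro ⟨h1, h2⟩
      rcases lt_or_gt_of_ne h1 with h | h
      · exact Or.inl h
      · exact Or.inr ⟨i - j - 1, by omega, by omega⟩
    · rintro (h | ⟨m, h1, h2⟩) <;> omega
  have hdisj : Disjoint (Finset.range j)
      ((Finset.range (n - j)).image (fun i => j + 1 + i)) := by
    rw [Finset.disjoint_left]
    simp only [Finset.mem_range, Finset.mem_image]
    rintro i h1 ⟨m, h2, h3⟩
    omega
  rw [hsplit, Finset.prod_union hdisj, Finset.prod_image (fun a _ b _ h => by simpa using h)]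
  congr 1
  · rw [← Finset.prod_range_reflect, ← Finset.prod_range_add_one_eq_factorial]
    push_cast
    refine Finset.prod_congr rfl fun i hi => ?_
    have hi := Finset.mem_range.1 hi
    rw [Nat.cast_sub (by omega), Nat.cast_sub (by omega)]
    push_cast
    rw [abs_of_nonneg] <;> ring_nf
    positivity
  · rw [← Finset.prod_range_add_one_eq_factorial]
    push_cast
    refine Finset.prod_congr rfl fun i hi => ?_
    rw [abs_of_nonpos] <;> ring_nf
    have : (0 : ℝ) ≤ i := by positivity
    linarith

/-- Interpolate at the nodes `j/n`. The leading factor of a basis polynomial is `n^n/n! · C(n,j) ≤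
e^n 2^n`, its monic part has coefficients at most `2^n`, and there are `n + 1` basis polynomials,
with `(n + 1) 4^n ≤ e^{3n}`. -/
theorem abs_coeff_le_of_abs_eval_le {P : ℝ[X]} {n : ℕ} (hP : P.natDegree ≤ n) {B : ℝ}
    (h : ∀ x, |x| ≤ 1 → |P.eval x| ≤ B) (k : ℕ) : |P.coeff k| ≤ B * exp (4 * n) := by
  classical
  -- For `n = 0`, division by zero yields the single node `0`, so this case needs no separate
  -- treatment beyond injectivity.
  let v : ℕ → ℝ := fun j => j / n
  let S := Finset.range (n + 1)
  have hB : 0 ≤ B := (abs_nonneg _).trans (h 0 (by simp))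
  have hv1 : ∀ j ∈ S, |v j| ≤ 1 := by
    intro j hj
    have hj : j ≤ n := by simpa [S, Nat.lt_succ_iff] using hj
    have h0 : (j : ℝ) ≤ n := by exact_mod_cast hj
    rw [abs_of_nonneg (by positivity)]
    exact div_le_one_of_le₀ h0 (by positivity)
  have hinj : Set.InjOn v S := by
    intro i hi j hj hij
    have hi : i ≤ n := by simpa [S, Nat.lt_succ_iff] using hi
    have hj : j ≤ n := by simpa [S, Nat.lt_succ_iff] using hj
    rcases Nat.eq_zero_or_pos n with h0 | h0
    · omega
    · have h0' : (n : ℝ) ≠ 0 := by positivity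
      simp only [v] at hij
      field_simp at hij
      exact_mod_cast hij
  have hPI : P = Lagrange.interpolate S v fun j => P.eval (v j) := by
    refine Lagrange.eq_interpolate_of_eval_eq _ hinj ?_ fun _ _ => rfl
    rw [Finset.card_range]
    exact (natDegree_le_iff_degree_le.1 hP).trans_lt (by exact_mod_cast Nat.lt_succ_self n)
  have hbasis : ∀ j ∈ S, |(Lagrange.basis S v j).coeff k| ≤ exp n * 4 ^ n := by
    intro j hj
    have hjn : j ≤ n := by simpa [S, Nat.lt_succ_iff] using hj
    have hcard : (S.erase j).card = n := by rw [Finset.card_erase_of_mem hj]; simp [S]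
    have heq : Lagrange.basis S v j =
        C (∏ i ∈ S.erase j, (v j - v i)⁻¹) * ∏ i ∈ S.erase j, (X - C (v i)) := by
      rw [Lagrange.basis, map_prod, ← Finset.prod_mul_distrib]
      rfl
    have hprod : |∏ i ∈ S.erase j, (v j - v i)⁻¹| ≤ exp n * 2 ^ n := by
      have h1 : |∏ i ∈ S.erase j, (v j - v i)⁻¹| =
          (n : ℝ) ^ n / n.factorial * n.choose j := by
        rw [Finset.abs_prod]
        have : ∀ i ∈ S.erase j, |(v j - v i)⁻¹| = n * |(j : ℝ) - i|⁻¹ := by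
          intro i _
          simp only [v]
          rw [← sub_div, abs_inv, abs_div, inv_div, Nat.abs_cast, div_eq_mul_inv]
        rw [Finset.prod_congr rfl this, Finset.prod_mul_distrib, Finset.prod_const, hcard,
          Finset.prod_inv_distrib, prod_erase_range_abs_sub hjn, Nat.cast_choose ℝ hjn]
        have := n.factorial_ne_zero
        field_simp
      rw [h1]
      refine mul_le_mul (pow_div_factorial_le_exp _ (by positivity) _) ?_ (by positivity)
        (exp_pos _).le
      exact_mod_cast Nat.choose_le_two_pow n j
    rw [heq, coeff_C_mul, abs_mul]
    have h2 := abs_coeff_prod_X_sub_C_le (S.erase j) v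
      (fun i hi => hv1 i (Finset.mem_of_mem_erase hi)) k
    rw [hcard] at h2
    calc _ ≤ (exp n * 2 ^ n) * 2 ^ n := mul_le_mul hprod h2 (abs_nonneg _) (by positivity)
      _ = exp n * 4 ^ n := by rw [mul_assoc, ← mul_pow]; norm_num
  have h8 : ((n : ℝ) + 1) * 4 ^ n ≤ exp (3 * n) := by
    have h1 : (n : ℝ) + 1 ≤ exp n := add_one_le_exp _
    have h2 : (4 : ℝ) ^ n ≤ exp (2 * n) := by
      have : (4 : ℝ) ≤ exp 2 := by
        have h3 := add_one_le_exp (1 : ℝ)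
        have h4 : exp 2 = exp 1 * exp 1 := by rw [← exp_add]; norm_num
        nlinarith
      calc (4 : ℝ) ^ n ≤ exp 2 ^ n := pow_le_pow_left₀ (by norm_num) this n
        _ = exp (2 * n) := by rw [← exp_nat_mul]; ring_nf
    calc _ ≤ exp n * exp (2 * n) := mul_le_mul h1 h2 (by positivity) (exp_pos _).le
      _ = _ := by rw [← exp_add]; ring_nf
  rw [hPI, Lagrange.interpolate_apply, finsetSum_coeff]
  calc |∑ j ∈ S, (C (P.eval (v j)) * Lagrange.basis S v j).coeff k|
      ≤ ∑ j ∈ S, |(C (P.eval (v j)) * Lagrange.basis S v j).coeff k| :=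
        Finset.abs_sum_le_sum_abs _ _
    _ ≤ ∑ j ∈ S, B * (exp n * 4 ^ n) := by
        refine Finset.sum_le_sum fun j hj => ?_
        rw [coeff_C_mul, abs_mul]
        exact mul_le_mul (h _ (hv1 j hj)) (hbasis j hj) (abs_nonneg _) hB
    _ = B * exp n * (((n : ℝ) + 1) * 4 ^ n) := by
        rw [Finset.sum_const, nsmul_eq_mul, Finset.card_range]
        push_cast
        ring
    _ ≤ B * exp n * exp (3 * n) := by gcongr
    _ = B * exp (4 * n) := by rw [mul_assoc, ← exp_add]; ring_nf

theorem abs_coeff_mul_pow_le {P : ℝ[X]} {n : ℕ} (hP : P.natDegree ≤ n) {M B : ℝ} (hM : 0 < M)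
    (h : ∀ x, |x| ≤ M → |P.eval x| ≤ B) (k : ℕ) : |P.coeff k| * M ^ k ≤ B * exp (4 * n) := by
  have h1 := abs_coeff_le_of_abs_eval_le (P := P.comp (C M * X)) (n := n) (B := B) ?_ ?_ k
  · rwa [comp_C_mul_X_coeff, abs_mul, abs_of_pos (pow_pos hM k)] at h1
  · refine natDegree_comp_le.trans ?_
    calc _ ≤ n * 1 := Nat.mul_le_mul hP ((natDegree_C_mul_le M X).trans natDegree_X_le)
      _ = n := mul_one n
  · intro x hx
    rw [eval_comp]
    refine h _ ?_
    simp only [eval_mul, eval_C, eval_X, abs_mul, abs_of_pos hM]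
    nlinarith

/-! ### Growth of Hermite polynomials -/

theorem derivative_hermite_succ (n : ℕ) :
    derivative (hermite (n + 1)) = (n + 1 : ℤ[X]) * hermite n := by
  induction n with
  | zero => simp
  | succ n ih =>
    rw [hermite_succ (n + 1), derivative_sub, derivative_mul, derivative_X, ih, derivative_mul]
    have h0 : derivative ((n : ℤ[X]) + 1) = 0 := by simp
    rw [h0, hermite_succ n]
    push_cast
    ring

theorem aeval_hermite_add_two (n : ℕ) (x : ℝ) : aeval x (hermite (n + 2)) =
    x * aeval x (hermite (n + 1)) - (n + 1) * aeval x (hermite n) := by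
  rw [hermite_succ (n + 1), derivative_hermite_succ]
  simp

/-- Induction on the three-term recurrence, with `n + 1 ≤ K = √K²`. Keeping `K` fixed while `k`
varies lets the two previous bounds share one base. -/
theorem abs_aeval_hermite_le {K : ℝ} {k : ℕ} (hk : (k : ℝ) ≤ K) (x : ℝ) :
    |aeval x (hermite k)| ≤ (|x| + √K) ^ k := by
  have hx := abs_nonneg x
  have hs := sqrt_nonneg K
  induction k using Nat.twoStepInduction with
  | zero => simp
  | one => simp
  | more n ih1 ih2 =>
    push_cast at hk ih2
    have h1 := ih1 (by linarith)
    have h2 := ih2 (by linarith)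
    have hK : √K * √K = K := mul_self_sqrt (by linarith [n.cast_nonneg (α := ℝ)])
    have hp : 0 ≤ (|x| + √K) ^ n := by positivity
    rw [aeval_hermite_add_two]
    calc _ ≤ |x * aeval x (hermite (n + 1))| + |((n : ℝ) + 1) * aeval x (hermite n)| :=
          abs_sub_le_abs_add_abs _ _
      _ ≤ |x| * (|x| + √K) ^ (n + 1) + K * (|x| + √K) ^ n := by
          rw [abs_mul, abs_mul, abs_of_nonneg (by positivity : (0 : ℝ) ≤ n + 1)]
          have : (n : ℝ) + 1 ≤ K := by linarith only [hk]
          have hK0 : 0 ≤ K := by linarith only [this, n.cast_nonneg (α := ℝ)]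
          gcongr
      _ = (|x| + √K) ^ n * (|x| ^ 2 + |x| * √K + √K * √K) := by rw [hK]; ring
      _ ≤ (|x| + √K) ^ n * (|x| + √K) ^ 2 := by
          gcongr
          nlinarith [mul_nonneg hx hs]
      _ = _ := by rw [pow_add]

/-! ### Exponential moments and tails of the Gaussian -/

theorem exp_mul_abs_le (a y : ℝ) :
    exp (a * |y|) ≤ exp (a * y) + exp (-a * y) := by
  rcases abs_cases y with ⟨h, _⟩ | ⟨h, _⟩ <;> rw [h]
  · linarith [exp_pos (-a * y)]
  · rw [mul_neg, ← neg_mul]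
    linarith [exp_pos (a * y)]

theorem integrable_exp_mul_sub_gaussianReal (μ m a : ℝ) :
    Integrable (fun x => exp (a * (x - m))) (gaussianReal μ 1) := by
  have h := (integrable_exp_mul_gaussianReal (μ := μ) (v := 1) a).mul_const (exp (-(a * m)))
  refine h.congr (ae_of_all _ fun x => ?_)
  dsimp only
  rw [← exp_add]
  ring_nf

theorem integral_exp_mul_sub_gaussianReal (μ m a : ℝ) :
    ∫ x, exp (a * (x - m)) ∂gaussianReal μ 1 = exp (a * (μ - m) + a ^ 2 / 2) := by
  have h : ∀ x, exp (a * (x - m)) = exp (a * x) * exp (-(a * m)) := fun x => by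
    rw [← exp_add]
    ring_nf
  simp_rw [h]
  rw [integral_mul_const]
  have h2 := mgf_gaussianReal (p := gaussianReal μ 1) (X := id) (μ := μ) (v := 1) (by simp) a
  rw [mgf] at h2
  simp only [id] at h2
  rw [h2, ← exp_add, NNReal.coe_one]
  ring_nf

theorem integrable_exp_mul_abs_sub_gaussianReal (μ m a : ℝ) :
    Integrable (fun x => exp (a * |x - m|)) (gaussianReal μ 1) := by
  refine ((integrable_exp_mul_sub_gaussianReal μ m a).add
    (integrable_exp_mul_sub_gaussianReal μ m (-a))).mono'
    (by fun_prop) (ae_of_all _ fun x => ?_)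
  rw [norm_of_nonneg (exp_pos _).le]
  exact exp_mul_abs_le a _

theorem integral_exp_mul_abs_sub_gaussianReal_le (μ m : ℝ) {a : ℝ} (ha : 0 ≤ a) :
    ∫ x, exp (a * |x - m|) ∂gaussianReal μ 1 ≤ 2 * exp (a * |μ - m| + a ^ 2 / 2) := by
  have h1 := integrable_exp_mul_sub_gaussianReal μ m a
  have h2 := integrable_exp_mul_sub_gaussianReal μ m (-a)
  calc _ ≤ ∫ x, (exp (a * (x - m)) + exp (-a * (x - m))) ∂gaussianReal μ 1 :=
        integral_mono (integrable_exp_mul_abs_sub_gaussianReal μ m a) (h1.add h2)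
          fun x => exp_mul_abs_le a _
    _ = exp (a * (μ - m) + a ^ 2 / 2) + exp (-a * (μ - m) + a ^ 2 / 2) := by
        rw [integral_add h1 h2, integral_exp_mul_sub_gaussianReal,
          integral_exp_mul_sub_gaussianReal, neg_sq]
    _ ≤ exp (a * |μ - m| + a ^ 2 / 2) + exp (a * |μ - m| + a ^ 2 / 2) := by
        gcongr ?_ + ?_
        · gcongr
          exact le_abs_self _
        · rw [neg_mul, ← mul_neg]
          gcongr
          exact neg_le_abs _
    _ = _ := (two_mul _).symm

/-- Chernoff's bound with parameter `t`, which minimizes `a²/2 - at` over `a`. -/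
theorem gaussianReal_real_le_abs_sub (μ : ℝ) {t : ℝ} (ht : 0 ≤ t) {A : Set ℝ}
    (hA : ∀ x ∈ A, t ≤ |x - μ|) : (gaussianReal μ 1).real A ≤ 2 * exp (-(t ^ 2 / 2)) := by
  have h := mul_meas_ge_le_integral_of_nonneg (μ := gaussianReal μ 1)
    (f := fun x => exp (t * |x - μ|)) (ae_of_all _ fun x => (exp_pos _).le)
    (integrable_exp_mul_abs_sub_gaussianReal μ μ t) (exp (t * t))
  have h2 := h.trans (integral_exp_mul_abs_sub_gaussianReal_le μ μ ht)
  have h3 : (gaussianReal μ 1).real A ≤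
      (gaussianReal μ 1).real {x | exp (t * t) ≤ exp (t * |x - μ|)} := by
    refine measureReal_mono fun x hx => ?_
    exact exp_le_exp.2 (mul_le_mul_of_nonneg_left (hA x hx) ht)
  have h4 : exp (t * t) * (gaussianReal μ 1).real A ≤ 2 * exp (t ^ 2 / 2) := by
    refine (mul_le_mul_of_nonneg_left h3 (exp_pos _).le).trans ?_
    simpa using h2
  calc _ = exp (-(t * t)) * (exp (t * t) * (gaussianReal μ 1).real A) := by
        rw [← mul_assoc, ← exp_add]; simp
    _ ≤ exp (-(t * t)) * (2 * exp (t ^ 2 / 2)) := by gcongr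
    _ = _ := by rw [mul_left_comm, ← exp_add]; ring_nf

/-! ### Unbiasedness and second moment of the Hermite estimate -/

theorem integrable_eval_gaussianReal (p : ℝ[X]) (μ : ℝ) :
    Integrable (fun x => p.eval x) (gaussianReal μ 1) := by
  induction p using Polynomial.induction_on' with
  | add p q hp hq => simp_rw [eval_add]; exact hp.add hq
  | monomial n a =>
    simp only [eval_monomial]
    refine Integrable.const_mul ?_ a
    have h := (memLp_id_gaussianReal (μ := μ) (v := 1) n).integrable_norm_pow'
    refine (integrable_norm_iff (by fun_prop)).1 ?_
    simpa [norm_pow] using h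

/-- Gaussian integration by parts: the derivative of density times `p` is the density times `p' - (x
- μ)p`, and it integrates to zero. -/
theorem integral_X_mul_sub_derivative_gaussianReal (p : ℝ[X]) (μ : ℝ) :
    ∫ x, (X * p - derivative p).eval x ∂gaussianReal μ 1 =
      μ * ∫ x, p.eval x ∂gaussianReal μ 1 := by
  have hd : ∀ x, HasDerivAt (fun x => gaussianPDFReal μ 1 x * p.eval x)
      (gaussianPDFReal μ 1 x * (derivative p - (X - C μ) * p).eval x) x := by
    intro x
    have h1 : HasDerivAt (gaussianPDFReal μ 1) (gaussianPDFReal μ 1 x * (-(x - μ))) x := by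
      have h2 : HasDerivAt (fun x : ℝ => -(x - μ) ^ 2 / (2 * (1 : NNReal))) (-(x - μ)) x := by
        have := (((hasDerivAt_id x).sub_const μ).pow 2).neg.div_const (2 * ((1 : NNReal) : ℝ))
        refine this.congr_deriv ?_
        simp
        ring
      have := (h2.exp).const_mul (√(2 * π * (1 : NNReal)))⁻¹
      refine (this.congr_deriv ?_)
      simp only [gaussianPDFReal]
      ring
    refine (h1.mul (p.hasDerivAt x)).congr_deriv ?_
    simp
    ring
  have hint : ∀ q : ℝ[X], Integrable fun x => gaussianPDFReal μ 1 x * q.eval x := by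
    intro q
    have h := integrable_eval_gaussianReal q μ
    rw [gaussianReal_of_var_ne_zero _ one_ne_zero, integrable_withDensity_iff_integrable_smul'
      (measurable_gaussianPDF _ _) (ae_of_all _ fun _ => gaussianPDF_lt_top)] at h
    simpa using h
  have h0 := integral_eq_zero_of_hasDerivAt_of_integrable hd (hint _) (hint _)
  have h1 : ∫ x, (derivative p - (X - C μ) * p).eval x ∂gaussianReal μ 1 = 0 := by
    rw [integral_gaussianReal_eq_integral_smul one_ne_zero]
    simpa only [smul_eq_mul] using h0
  have h2 : ∀ x, (X * p - derivative p).eval x =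
      μ * p.eval x - (derivative p - (X - C μ) * p).eval x := fun x => by simp; ring
  simp_rw [h2]
  rw [integral_sub ((integrable_eval_gaussianReal p μ).const_mul μ)
    (integrable_eval_gaussianReal _ μ), h1, sub_zero, integral_const_mul]

theorem integral_hermite_gaussianReal (k : ℕ) (μ : ℝ) :
    ∫ x, aeval x (hermite k) ∂gaussianReal μ 1 = μ ^ k := by
  have hmap : ∀ k (x : ℝ), aeval x (hermite k) =
      ((hermite k).map (Int.castRingHom ℝ)).eval x := fun k x => by
    rw [aeval_def, eval₂_eq_eval_map]; rfl
  induction k with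
  | zero => simp
  | succ k ih =>
    simp_rw [hmap] at ih ⊢
    have : (hermite (k + 1)).map (Int.castRingHom ℝ) = X * (hermite k).map (Int.castRingHom ℝ) -
        derivative ((hermite k).map (Int.castRingHom ℝ)) := by
      rw [hermite_succ, Polynomial.map_sub, Polynomial.map_mul, map_X, derivative_map]
    rw [this, integral_X_mul_sub_derivative_gaussianReal, ih, pow_succ, mul_comm]

theorem exists_hermiteEstimate_eq_eval (K : ℝ) (P : ℝ[X]) :
    ∃ Q : ℝ[X], hermiteEstimate K P = fun x => Q.eval x := by
  refine ⟨∑ k ∈ Finset.Icc 1 ⌊K⌋₊, C (P.coeff k) * (hermite k).map (Int.castRingHom ℝ), ?_⟩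
  funext x
  rw [hermiteEstimate, eval_finsetSum]
  refine Finset.sum_congr rfl fun k _ => ?_
  rw [eval_mul, eval_C, aeval_def, eval₂_eq_eval_map]
  rfl

theorem measurable_hermiteEstimate (K : ℝ) (P : ℝ[X]) : Measurable (hermiteEstimate K P) := by
  obtain ⟨Q, hQ⟩ := exists_hermiteEstimate_eq_eval K P
  rw [hQ]
  exact Q.continuous.measurable

theorem integrable_hermiteEstimate_sq (K : ℝ) (P : ℝ[X]) (μ : ℝ) :
    Integrable (fun x => hermiteEstimate K P x ^ 2) (gaussianReal μ 1) := by
  obtain ⟨Q, hQ⟩ := exists_hermiteEstimate_eq_eval K P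
  simp_rw [hQ, ← eval_pow]
  exact integrable_eval_gaussianReal (Q ^ 2) μ

/-- The degree bound makes truncation at `⌊K⌋` harmless; omitting `k = 0` produces the term `-P(0)`,
hence no bias at zero. -/
theorem integral_hermiteEstimate {K : ℝ} {P : ℝ[X]} (hP : (P.natDegree : ℝ) ≤ K) (μ : ℝ) :
    ∫ x, hermiteEstimate K P x ∂gaussianReal μ 1 = P.eval μ - P.eval 0 := by
  have hint : ∀ k, Integrable (fun x : ℝ => aeval x (hermite k)) (gaussianReal μ 1) := fun k => by
    refine (integrable_eval_gaussianReal ((hermite k).map (Int.castRingHom ℝ)) μ).congr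
      (ae_of_all _ fun x => ?_)
    dsimp only
    rw [aeval_def, eval₂_eq_eval_map]
    rfl
  simp only [hermiteEstimate]
  rw [integral_finsetSum _ fun k _ => (hint k).const_mul _]
  simp_rw [integral_const_mul, integral_hermite_gaussianReal]
  have hPK : P.natDegree < ⌊K⌋₊ + 1 := Nat.lt_succ_of_le (Nat.le_floor hP)
  rw [eval_eq_sum_range' hPK, ← coeff_zero_eq_eval_zero, Finset.sum_range_succ',
    pow_zero, mul_one, add_sub_cancel_right, Finset.range_eq_Ico,
    Finset.sum_Ico_add' (fun k => P.coeff k * μ ^ k)]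
  rfl

/-- Since `√K ≤ M`, one has `(|x| + √K)/M ≤ 1 + |x|/M ≤ e^{|x|/M}`, whose `k`-th power is at most
`e^{K|x|/M}`. The number of terms is absorbed by `e^K`. -/
theorem abs_hermiteEstimate_le {K M B : ℝ} {P : ℝ[X]} (hM : 0 < M) (hK : 0 ≤ K)
    (hKM : K ≤ M ^ 2) (hB : 0 ≤ B) (hP : ∀ k ≠ 0, |P.coeff k| * M ^ k ≤ B) (x : ℝ) :
    |hermiteEstimate K P x| ≤ B * exp (K + K * |x| / M) := by
  have hfl : (⌊K⌋₊ : ℝ) ≤ K := Nat.floor_le hK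
  have hterm : ∀ k ∈ Finset.Icc 1 ⌊K⌋₊,
      |P.coeff k * aeval x (hermite k)| ≤ B * exp (K * |x| / M) := by
    intro k hk
    rw [Finset.mem_Icc] at hk
    have hkK : (k : ℝ) ≤ K := (Nat.cast_le.2 hk.2).trans hfl
    have hsq : √K ≤ M := sqrt_le_left hM.le |>.2 hKM
    have h1 : (|x| + √K) / M ≤ exp (|x| / M) := by
      refine le_trans ?_ (add_one_le_exp _)
      rw [add_div]
      gcongr
      exact div_le_one_of_le₀ hsq hM.le
    calc _ = |P.coeff k| * |aeval x (hermite k)| := abs_mul _ _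
      _ ≤ |P.coeff k| * (|x| + √K) ^ k := by gcongr; exact abs_aeval_hermite_le hkK x
      _ = (|P.coeff k| * M ^ k) * ((|x| + √K) / M) ^ k := by
          rw [div_pow]
          have := (pow_pos hM k).ne'
          field_simp
      _ ≤ B * exp (|x| / M) ^ k := by
          gcongr
          exact hP k (by omega)
      _ = B * exp (k * (|x| / M)) := by rw [← exp_nat_mul]
      _ ≤ B * exp (K * |x| / M) := by rw [← mul_div_assoc]; gcongr
  calc _ ≤ ∑ k ∈ Finset.Icc 1 ⌊K⌋₊, |P.coeff k * aeval x (hermite k)| :=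
        Finset.abs_sum_le_sum_abs _ _
    _ ≤ ∑ k ∈ Finset.Icc 1 ⌊K⌋₊, B * exp (K * |x| / M) := Finset.sum_le_sum hterm
    _ = ⌊K⌋₊ * (B * exp (K * |x| / M)) := by simp
    _ ≤ exp K * (B * exp (K * |x| / M)) := by
        gcongr
        linarith [add_one_le_exp K]
    _ = _ := by rw [exp_add]; ring

theorem integral_hermiteEstimate_sq_le {K M B : ℝ} {P : ℝ[X]} (hM : 0 < M) (hK : 0 ≤ K)
    (hKM : K ≤ M ^ 2) (hB : 0 ≤ B) (hP : ∀ k ≠ 0, |P.coeff k| * M ^ k ≤ B) (μ : ℝ) :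
    ∫ x, hermiteEstimate K P x ^ 2 ∂gaussianReal μ 1 ≤
      2 * B ^ 2 * exp (2 * K + 2 * K / M * |μ| + (2 * K / M) ^ 2 / 2) := by
  have ha : 0 ≤ 2 * K / M := by positivity
  have hint := integrable_exp_mul_abs_sub_gaussianReal μ 0 (2 * K / M)
  have h := integral_exp_mul_abs_sub_gaussianReal_le μ 0 ha
  simp only [sub_zero] at hint h
  calc _ ≤ ∫ x, B ^ 2 * exp (2 * K) * exp (2 * K / M * |x|) ∂gaussianReal μ 1 := by
        refine integral_mono (integrable_hermiteEstimate_sq K P μ) (hint.const_mul _) fun x => ?_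
        calc hermiteEstimate K P x ^ 2 = |hermiteEstimate K P x| ^ 2 := (sq_abs _).symm
          _ ≤ (B * exp (K + K * |x| / M)) ^ 2 := by
              gcongr
              exact abs_hermiteEstimate_le hM hK hKM hB hP x
          _ = _ := by
              rw [mul_pow, ← exp_nat_mul, mul_assoc, ← exp_add]
              push_cast
              ring_nf
    _ = B ^ 2 * exp (2 * K) * ∫ x, exp (2 * K / M * |x|) ∂gaussianReal μ 1 :=
        integral_const_mul _ _
    _ ≤ B ^ 2 * exp (2 * K) * (2 * exp (2 * K / M * |μ| + (2 * K / M) ^ 2 / 2)) := by gcongr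
    _ = _ := by rw [add_assoc (2 * K), exp_add (2 * K)]; ring

/-! ### The dyadic scales -/

theorem four_le_sq_div {d : ℕ} {s : ℝ} (hd : 1 ≤ d) (hs : 2 * √d ≤ s) : 4 ≤ s ^ 2 / d := by
  have hd0 : (0 : ℝ) < d := by exact_mod_cast hd
  rw [le_div_iff₀ hd0]
  have := Real.sq_sqrt hd0.le
  nlinarith [Real.sqrt_nonneg (d : ℝ)]

theorem one_le_log_four : 1 ≤ log 4 := by
  have : log 4 = 2 * log 2 := by
    rw [show (4 : ℝ) = 2 ^ 2 by norm_num, log_pow]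
    norm_num
  linarith [log_two_gt_d9]

theorem one_le_log_sq_div {d : ℕ} {s : ℝ} (hd : 1 ≤ d) (hs : 2 * √d ≤ s) :
    1 ≤ log (s ^ 2 / d) :=
  one_le_log_four.trans (log_le_log (by norm_num) (four_le_sq_div hd hs))

theorem one_le_sqrt_two_log {d : ℕ} {s : ℝ} (hd : 1 ≤ d) (hs : 2 * √d ≤ s) :
    1 ≤ √(2 * log (s ^ 2 / d)) :=
  one_le_sqrt.2 (by linarith [one_le_log_sq_div hd hs])

theorem sqrt_log_eq_ratio_mul {d : ℕ} {s : ℝ} (hd : 1 ≤ d) (hs : 2 * √d ≤ s) :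
    √(2 * log d) = √(log d / log (s ^ 2 / d)) * √(2 * log (s ^ 2 / d)) := by
  have h := one_le_log_sq_div hd hs
  have h0 : 0 ≤ log d := log_natCast_nonneg d
  rw [← sqrt_mul (by positivity)]
  congr 1
  field_simp

theorem lastIndex_cast {d : ℕ} {s : ℝ} (hd : 1 ≤ d) (hs : 2 * √d ≤ s) (hsd : s ≤ d) :
    (lastIndex d s : ℤ) = topLevel d s + 1 := by
  have := (topLevel_spec hd hs hsd).2
  rw [lastIndex, Int.toNat_of_nonneg (by omega)]

theorem two_pow_mul_le_of_lt_lastIndex {d : ℕ} {s : ℝ} (hd : 1 ≤ d) (hs : 2 * √d ≤ s)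
    (hsd : s ≤ d) {l : ℕ} (hl : l < lastIndex d s) :
    2 ^ l * √(2 * log (s ^ 2 / d)) ≤ √(2 * log d) := by
  have hspec := (topLevel_spec hd hs hsd).1.1
  have hN := lastIndex_cast hd hs hsd
  have hlt : (2 : ℝ) ^ l ≤ √(log d / log (s ^ 2 / d)) := by
    rw [← zpow_natCast]
    refine le_trans ?_ (le_of_lt hspec)
    exact zpow_le_zpow_right₀ one_le_two (by omega)
  rw [sqrt_log_eq_ratio_mul hd hs]
  gcongr

theorem le_two_pow_lastIndex_mul {d : ℕ} {s : ℝ} (hd : 1 ≤ d) (hs : 2 * √d ≤ s)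
    (hsd : s ≤ d) :
    √(2 * log d) ≤ 2 ^ lastIndex d s * √(2 * log (s ^ 2 / d)) := by
  have hN := lastIndex_cast hd hs hsd
  have hle : √(log d / log (s ^ 2 / d)) ≤ (2 : ℝ) ^ lastIndex d s := by
    by_contra! h
    rw [← zpow_natCast] at h
    have := (topLevel_spec hd hs hsd).1.2 h
    omega
  rw [sqrt_log_eq_ratio_mul hd hs]
  gcongr

theorem sqrt_log_le_sqrt_log {d : ℕ} {s : ℝ} (hd : 1 ≤ d) (hs : 2 * √d ≤ s) (hsd : s ≤ d) :
    √(2 * log (s ^ 2 / d)) ≤ √(2 * log d) := by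
  have hd0 : (0 : ℝ) < d := by exact_mod_cast hd
  have h4 := four_le_sq_div hd hs
  have hle : s ^ 2 / d ≤ d := by
    rw [div_le_iff₀ hd0]
    nlinarith [Real.sqrt_nonneg (d : ℝ)]
  gcongr

theorem scale_lastIndex (d : ℕ) (s : ℝ) : scale d s (lastIndex d s) = √(2 * log d) := by
  simp [scale]

/-- This holds for every `l`, as `scale` stays at `√(2 log d)` past the last index. -/
theorem scale_mem_Icc {d : ℕ} {s : ℝ} (hd : 1 ≤ d) (hs : 2 * √d ≤ s) (hsd : s ≤ d) (l : ℕ) :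
    scale d s l ∈ Set.Icc (√(2 * log (s ^ 2 / d))) (√(2 * log d)) := by
  rw [scale]
  split_ifs with h
  · refine ⟨?_, two_pow_mul_le_of_lt_lastIndex hd hs hsd h⟩
    exact le_mul_of_one_le_left (sqrt_nonneg _) (one_le_pow₀ one_le_two)
  · exact ⟨sqrt_log_le_sqrt_log hd hs hsd, le_rfl⟩

theorem one_le_scale {d : ℕ} {s : ℝ} (hd : 1 ≤ d) (hs : 2 * √d ≤ s) (hsd : s ≤ d) (l : ℕ) :
    1 ≤ scale d s l :=
  (one_le_sqrt_two_log hd hs).trans (scale_mem_Icc hd hs hsd l).1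

theorem scale_zero {d : ℕ} {s : ℝ} (hd : 1 ≤ d) (hs : 2 * √d ≤ s) (hsd : s ≤ d) :
    scale d s 0 = √(2 * log (s ^ 2 / d)) := by
  rw [scale]
  split_ifs with h
  · simp
  · have h0 : lastIndex d s = 0 := by omega
    have := le_two_pow_lastIndex_mul hd hs hsd
    rw [h0, pow_zero, one_mul] at this
    exact le_antisymm this (sqrt_log_le_sqrt_log hd hs hsd)

theorem scale_le_scale_succ {d : ℕ} {s : ℝ} (hd : 1 ≤ d) (hs : 2 * √d ≤ s) (hsd : s ≤ d)
    (l : ℕ) : scale d s l ≤ scale d s (l + 1) := by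
  by_cases h : l + 1 < lastIndex d s
  · rw [scale, scale, if_pos h, if_pos (by omega)]
    gcongr <;> norm_num
  · have : scale d s (l + 1) = √(2 * log d) := by rw [scale, if_neg h]
    rw [this]
    exact (scale_mem_Icc hd hs hsd l).2

/-- The last ratio is also at most `2`, by maximality of `L`. Hence exceeding `t_l` forces `|v| >
M_{l+1}/4`. -/
theorem scale_succ_le {d : ℕ} {s : ℝ} (hd : 1 ≤ d) (hs : 2 * √d ≤ s) (hsd : s ≤ d)
    {l : ℕ} (hl : l < lastIndex d s) : scale d s (l + 1) ≤ 2 * scale d s l := by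
  rw [scale, scale, if_pos hl]
  split_ifs with h
  · rw [pow_succ]
    linarith
  · have h1 : lastIndex d s = l + 1 := by omega
    have := le_two_pow_lastIndex_mul hd hs hsd
    rw [h1, pow_succ] at this
    linarith

theorem two_pow_le_scale_sq {d : ℕ} {s : ℝ} (hd : 1 ≤ d) (hs : 2 * √d ≤ s)
    {l : ℕ} (hl : l < lastIndex d s) : 2 ^ l ≤ scale d s l ^ 2 := by
  have h2 : (1 : ℝ) ≤ 2 ^ l := one_le_pow₀ one_le_two
  have h1 := one_le_sqrt_two_log hd hs
  rw [scale, if_pos hl]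
  have h3 : (2 : ℝ) ^ l ≤ 2 ^ l * √(2 * log (s ^ 2 / d)) := le_mul_of_one_le_right (by positivity) h1
  nlinarith

/-- Each exponential is at most `1/(b 2^l)`, giving a bound free of the number of levels. -/
theorem sum_exp_neg_scale_sq_le {d : ℕ} {s : ℝ} (hd : 1 ≤ d) (hs : 2 * √d ≤ s)
    {b : ℝ} (hb : 0 < b) :
    ∑ l ∈ Finset.range (lastIndex d s + 1), exp (-(b * scale d s l ^ 2)) ≤ 2 / b + 1 := by
  rw [Finset.sum_range_succ]
  -- The last scale need not be twice its predecessor, so its term is bounded separately.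
  have h1 : exp (-(b * scale d s (lastIndex d s) ^ 2)) ≤ 1 :=
    exp_le_one_iff.2 (neg_nonpos.2 (by positivity))
  have h2 : ∀ l ∈ Finset.range (lastIndex d s),
      exp (-(b * scale d s l ^ 2)) ≤ 1 / b * (1 / 2) ^ l := by
    intro l hl
    have h := two_pow_le_scale_sq hd hs (Finset.mem_range.1 hl)
    have hp : (0 : ℝ) < 2 ^ l := by positivity
    have hexp : b * 2 ^ l ≤ exp (b * scale d s l ^ 2) := by
      have := add_one_le_exp (b * scale d s l ^ 2)
      have := mul_le_mul_of_nonneg_left h hb.le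
      linarith
    calc _ = (exp (b * scale d s l ^ 2))⁻¹ := exp_neg _
      _ ≤ (b * 2 ^ l)⁻¹ := by gcongr
      _ = _ := by rw [mul_inv, one_div, one_div, inv_pow]
  have h3 := sum_geometric_two_le (lastIndex d s)
  calc _ ≤ ∑ l ∈ Finset.range (lastIndex d s), 1 / b * (1 / 2) ^ l + 1 :=
        add_le_add (Finset.sum_le_sum h2) h1
    _ = 1 / b * ∑ l ∈ Finset.range (lastIndex d s), (1 / (2 : ℝ)) ^ l + 1 := by
        rw [Finset.mul_sum]
    _ ≤ 1 / b * 2 + 1 := by gcongr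
    _ = _ := by ring

/-! ### Selection of a scale by the second sample -/

/-- The indicator that `v` selects the scale `l`. -/
noncomputable def scaleWeight (d : ℕ) (s : ℝ) (l : ℕ) (v : ℝ) : ℝ :=
  if prevThreshold d s l < |v| ∧ (l < lastIndex d s → |v| ≤ threshold d s l) then 1 else 0

theorem scaleWeight_nonneg (d : ℕ) (s : ℝ) (l : ℕ) (v : ℝ) : 0 ≤ scaleWeight d s l v := by
  rw [scaleWeight]
  split_ifs <;> norm_num

theorem scaleWeight_le_one (d : ℕ) (s : ℝ) (l : ℕ) (v : ℝ) : scaleWeight d s l v ≤ 1 := by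
  rw [scaleWeight]
  split_ifs <;> norm_num

theorem scaleWeight_sq (d : ℕ) (s : ℝ) (l : ℕ) (v : ℝ) :
    scaleWeight d s l v ^ 2 = scaleWeight d s l v := by
  rw [scaleWeight]
  split_ifs <;> norm_num

theorem measurable_scaleWeight (d : ℕ) (s : ℝ) (l : ℕ) : Measurable (scaleWeight d s l) := by
  refine Measurable.ite ?_ measurable_const measurable_const
  have h1 : Measurable fun v : ℝ => |v| := by fun_prop
  refine (measurableSet_lt measurable_const h1).inter ?_
  by_cases h : l < lastIndex d s
  · simp only [h, forall_const]
    exact measurableSet_le h1 measurable_const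
  · simp only [h, false_imp_iff]
    exact MeasurableSet.univ

/-- The weight imposes its upper threshold only below the last index, so the unbounded last level
joins the same sum. -/
theorem coordEstimator_eq_sum (c : ℝ) (d : ℕ) (s : ℝ) (P : ℕ → ℝ[X]) (u v : ℝ) :
    coordEstimator c d s P u v = ∑ l ∈ Finset.range (lastIndex d s + 1),
      hermiteEstimate (deg c d s l) (P l) u * scaleWeight d s l v := by
  rw [Finset.sum_range_succ, coordEstimator]
  congr 1
  · refine Finset.sum_congr rfl fun l hl => ?_
    simp [scaleWeight, Finset.mem_range.1 hl]
  · simp [scaleWeight]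

theorem sum_scaleWeight {d : ℕ} {s : ℝ} (hd : 1 ≤ d) (hs : 2 * √d ≤ s) (hsd : s ≤ d) (v : ℝ) :
    ∑ l ∈ Finset.range (lastIndex d s + 1), scaleWeight d s l v = if v = 0 then 0 else 1 := by
  -- Invariant: replacing the tail `|v| > t_{n-1}` by level `n` and the tail `|v| > t_n` changes
  -- nothing.
  have key : ∀ n ≤ lastIndex d s, ∑ l ∈ Finset.range n, scaleWeight d s l v +
      (if prevThreshold d s n < |v| then 1 else 0) = if v = 0 then 0 else 1 := by
    intro n hn
    induction n with
    | zero => by_cases h : v = 0 <;> simp [prevThreshold, h]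
    | succ n ih =>
      rw [← ih (by omega), Finset.sum_range_succ, add_assoc]
      congr 1
      have hle : prevThreshold d s n ≤ threshold d s n := by
        cases n with
        | zero =>
          have := one_le_scale hd hs hsd 0
          simp only [prevThreshold, threshold]
          linarith
        | succ n =>
          have := scale_le_scale_succ hd hs hsd n
          simp only [prevThreshold, threshold]
          linarith
      have hn : n < lastIndex d s := by omega
      simp only [scaleWeight, hn, forall_const]
      change (_ + if threshold d s n < |v| then _ else _) = _
      rcases le_or_gt |v| (threshold d s n) with h | h
      · simp [h, not_lt.2 h]
      · simp [h, not_le.2 h, hle.trans_lt h]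
  rw [Finset.sum_range_succ, ← key _ le_rfl]
  simp [scaleWeight]

theorem sum_scaleWeight_le_one {d : ℕ} {s : ℝ} (hd : 1 ≤ d) (hs : 2 * √d ≤ s) (hsd : s ≤ d)
    (v : ℝ) : ∑ l ∈ Finset.range (lastIndex d s + 1), scaleWeight d s l v ≤ 1 := by
  rw [sum_scaleWeight hd hs hsd]
  split_ifs <;> norm_num

theorem integrable_scaleWeight (d : ℕ) (s : ℝ) (l : ℕ) (μ : ℝ) :
    Integrable (scaleWeight d s l) (gaussianReal μ 1) := by
  refine Integrable.of_bound (measurable_scaleWeight d s l).aestronglyMeasurable 1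
    (ae_of_all _ fun v => ?_)
  rw [norm_of_nonneg (scaleWeight_nonneg ..)]
  exact scaleWeight_le_one ..

/-- The probability that an observation with mean `μ` selects the scale `l`. -/
noncomputable def scaleProb (d : ℕ) (s : ℝ) (l : ℕ) (μ : ℝ) : ℝ :=
  ∫ v, scaleWeight d s l v ∂gaussianReal μ 1

theorem scaleProb_nonneg (d : ℕ) (s : ℝ) (l : ℕ) (μ : ℝ) : 0 ≤ scaleProb d s l μ :=
  integral_nonneg fun v => scaleWeight_nonneg d s l v

theorem sum_scaleProb {d : ℕ} {s : ℝ} (hd : 1 ≤ d) (hs : 2 * √d ≤ s) (hsd : s ≤ d) (μ : ℝ) :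
    ∑ l ∈ Finset.range (lastIndex d s + 1), scaleProb d s l μ = 1 := by
  simp only [scaleProb]
  rw [← integral_finsetSum _ fun l _ => integrable_scaleWeight d s l μ]
  -- No level is selected at `v = 0`, because `t_{-1} = 0` is excluded; this is a null event.
  have : ∀ᵐ v ∂gaussianReal μ 1, ∑ l ∈ Finset.range (lastIndex d s + 1), scaleWeight d s l v = 1 := by
    have := nullSingletonClass_gaussianReal (μ := μ) (v := 1) one_ne_zero
    have h0 : ∀ᵐ v ∂gaussianReal μ 1, v ≠ 0 := by simp [ae_iff]
    filter_upwards [h0] with v hv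
    rw [sum_scaleWeight hd hs hsd, if_neg hv]
  rw [integral_congr_ae this]
  simp

theorem scaleProb_le_one {d : ℕ} {s : ℝ} (hd : 1 ≤ d) (hs : 2 * √d ≤ s) (hsd : s ≤ d) {l : ℕ}
    (hl : l ∈ Finset.range (lastIndex d s + 1)) (μ : ℝ) : scaleProb d s l μ ≤ 1 := by
  rw [← sum_scaleProb hd hs hsd μ]
  exact Finset.single_le_sum (f := fun l => scaleProb d s l μ)
    (fun l _ => scaleProb_nonneg d s l μ) hl

theorem scaleProb_le_of_le_abs_sub {d : ℕ} {s : ℝ} {l : ℕ} {μ t : ℝ} (ht : 0 ≤ t)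
    (h : ∀ v, scaleWeight d s l v ≠ 0 → t ≤ |v - μ|) :
    scaleProb d s l μ ≤ 2 * exp (-(t ^ 2 / 2)) := by
  have hm : MeasurableSet {v | scaleWeight d s l v ≠ 0} :=
    (measurable_scaleWeight d s l) (measurableSet_singleton 0).compl
  have heq : scaleWeight d s l = {v | scaleWeight d s l v ≠ 0}.indicator 1 := by
    funext v
    simp only [Set.indicator, Set.mem_ofPred_eq, Pi.one_apply]
    rw [scaleWeight]
    split_ifs <;> simp_all
  rw [scaleProb, heq, integral_indicator_one hm]
  exact gaussianReal_real_le_abs_sub μ ht h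

theorem scaleProb_succ_zero_le {d : ℕ} {s : ℝ} (hd : 1 ≤ d) (hs : 2 * √d ≤ s) (hsd : s ≤ d)
    {l : ℕ} (hl : l < lastIndex d s) :
    scaleProb d s (l + 1) 0 ≤ 2 * exp (-(1 / 32 * scale d s (l + 1) ^ 2)) := by
  have h1 := one_le_scale hd hs hsd (l + 1)
  have h := scaleProb_le_of_le_abs_sub (d := d) (s := s) (l := l + 1) (μ := 0)
    (t := scale d s (l + 1) / 4) (by linarith) fun v hv => ?_
  · calc _ ≤ _ := h
      _ = _ := by ring_nf
  · have hv : prevThreshold d s (l + 1) < |v| := by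
      by_contra hc
      simp [scaleWeight, hc] at hv
    have := scale_succ_le hd hs hsd hl
    rw [prevThreshold, threshold] at hv
    rw [sub_zero]
    linarith

/-- Selecting a level below `|μ|` means `|v| ≤ M_l/2 < |μ|/2`, so `v` is at distance at least
`|μ|/2` from its mean. -/
theorem scaleProb_le_of_scale_lt {d : ℕ} {s : ℝ} {l : ℕ} (hl : l < lastIndex d s) {μ : ℝ}
    (hμ : scale d s l < |μ|) : scaleProb d s l μ ≤ 2 * exp (-(1 / 8 * μ ^ 2)) := by
  have h := scaleProb_le_of_le_abs_sub (d := d) (s := s) (l := l) (μ := μ)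
    (t := |μ| / 2) (by positivity) fun v hv => ?_
  · calc _ ≤ _ := h
      _ = _ := by rw [div_pow, sq_abs]; ring_nf
  · have hv : |v| ≤ threshold d s l := by
      by_contra hc
      simp [scaleWeight, hc, hl] at hv
    rw [threshold] at hv
    have := abs_sub_abs_le_abs_sub μ v
    rw [abs_sub_comm] at this
    linarith

/-! ### Consequences of (A1) and (A2) -/

theorem enorm_le_supNorm {M x : ℝ} (f : ℝ → ℝ) (hx : |x| ≤ M) : ‖f x‖ₑ ≤ supNorm M f :=
  le_iSup₂_of_le (f := fun x (_ : x ∈ Set.Icc (-M) M) => ‖f x‖ₑ) x (abs_le.1 hx) le_rfl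

theorem AssumptionA1.supNorm_le {F : ℝ → ℝ} {d : ℕ} {s ε C M : ℝ} (h : AssumptionA1 F d s ε C)
    (hC : 0 ≤ C) (hM : M ∈ Set.Icc (√(2 * log (s ^ 2 / d))) (√(2 * log d))) :
    supNorm M (fun x => F x - F 0) ≤ ENNReal.ofReal (C * exp (ε * M ^ 2)) := by
  have h1 := (iSup₂_le_iff.1 h) M hM
  rw [ENNReal.div_le_iff (by simpa using exp_pos _) ENNReal.ofReal_ne_top] at h1
  rwa [ENNReal.ofReal_mul hC]

theorem AssumptionA1.abs_sub_le {F : ℝ → ℝ} {d : ℕ} {s ε C M x : ℝ}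
    (h : AssumptionA1 F d s ε C) (hC : 0 ≤ C)
    (hM : M ∈ Set.Icc (√(2 * log (s ^ 2 / d))) (√(2 * log d))) (hx : |x| ≤ M) :
    |F x - F 0| ≤ C * exp (ε * M ^ 2) := by
  have h1 := (enorm_le_supNorm (fun x => F x - F 0) hx).trans (h.supNorm_le hC hM)
  rwa [Real.enorm_eq_ofReal_abs, ENNReal.ofReal_le_ofReal_iff (by positivity)] at h1

theorem approxRate_le_supNorm_sub {F : ℝ → ℝ} {K M : ℝ} (hK : 0 ≤ K) :
    approxRate F K M ≤ supNorm M (fun x => F x - F 0) := by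
  refine (iInf₂_le
    (f := fun (P : ℝ[X]) (_ : (P.natDegree : ℝ) ≤ K) => supNorm M (fun x => F x - P.eval x))
    (C (F 0)) (by simpa using hK)).trans ?_
  simp

theorem approxRate_anti {F : ℝ → ℝ} {K K' M : ℝ} (hK : K ≤ K') :
    approxRate F K' M ≤ approxRate F K M :=
  le_iInf₂ fun P hP => iInf₂_le
    (f := fun (P : ℝ[X]) (_ : (P.natDegree : ℝ) ≤ K') => supNorm M (fun x => F x - P.eval x))
    P (hP.trans hK)

theorem AssumptionA1.approxRate_le {F : ℝ → ℝ} {d : ℕ} {s ε C K M : ℝ}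
    (h : AssumptionA1 F d s ε C) (hC : 0 ≤ C)
    (hM : M ∈ Set.Icc (√(2 * log (s ^ 2 / d))) (√(2 * log d))) (hK : 0 ≤ K) :
    approxRate F K M ≤ ENNReal.ofReal (C * exp (ε * M ^ 2)) :=
  (approxRate_le_supNorm_sub hK).trans (h.supNorm_le hC hM)

/-- (A2) concerns degree `M²`; the rate only grows when the degree drops to `K`. Finiteness is
needed because `toReal` sends `∞` to `0`. -/
theorem AssumptionA2.one_le_mul_approxRate {F : ℝ → ℝ} {d : ℕ} {s ε C K M : ℝ}
    (h : AssumptionA2 F d s ε C) (hC : 0 ≤ C)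
    (hM : M ∈ Set.Icc (√(2 * log (s ^ 2 / d))) (√(2 * log d))) (hK : K ≤ M ^ 2)
    (hfin : approxRate F K M ≠ ∞) :
    1 ≤ C * exp (ε * M ^ 2) * (approxRate F K M).toReal := by
  have h1 := (iSup₂_le_iff.1 h) M hM
  rw [ENNReal.div_le_iff (by simpa using exp_pos _) ENNReal.ofReal_ne_top,
    ← ENNReal.ofReal_mul hC] at h1
  have h2 := (ENNReal.inv_le_inv.2 (approxRate_anti (F := F) (M := M) hK)).trans h1
  have h0 : approxRate F K M ≠ 0 := by
    rintro h0
    rw [h0, ENNReal.inv_zero] at h2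
    exact ENNReal.ofReal_ne_top (top_le_iff.1 h2)
  have hpos : 0 < (approxRate F K M).toReal := ENNReal.toReal_pos h0 hfin
  have h3 := ENNReal.toReal_mono ENNReal.ofReal_ne_top h2
  rw [ENNReal.toReal_inv, ENNReal.toReal_ofReal (by positivity)] at h3
  rwa [inv_le_iff_one_le_mul₀ hpos] at h3

theorem IsBestApprox.abs_sub_eval_le {F : ℝ → ℝ} {K M x : ℝ}
    {P : ℝ[X]} (hP : IsBestApprox F K M P) (hfin : approxRate F K M ≠ ∞) (hx : |x| ≤ M) :
    |F x - P.eval x| ≤ (approxRate F K M).toReal := by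
  have h := (enorm_le_supNorm (fun x => F x - P.eval x) hx).trans hP.2.le
  have := ENNReal.toReal_mono hfin h
  simpa using this

/-- Comparison with the constant `F(0)` gives `δ ≤ A`, so `P - F(0)` is at most `2A` on the
interval. Subtracting the constant alters only the coefficient `k = 0`. -/
theorem IsBestApprox.abs_coeff_mul_pow_le {F : ℝ → ℝ} {K M A : ℝ}
    {P : ℝ[X]} (hP : IsBestApprox F K M P) (hM : 0 < M) (hA : 0 ≤ A)
    (hF : supNorm M (fun x => F x - F 0) ≤ ENNReal.ofReal A) {k : ℕ} (hk : k ≠ 0) :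
    |P.coeff k| * M ^ k ≤ 2 * A * exp (4 * K) := by
  have hK : 0 ≤ K := (Nat.cast_nonneg _).trans hP.1
  have hδ := (approxRate_le_supNorm_sub (F := F) (M := M) hK).trans hF
  have hfin : approxRate F K M ≠ ∞ := ne_top_of_le_ne_top ENNReal.ofReal_ne_top hδ
  have hδ' : (approxRate F K M).toReal ≤ A := by
    have := ENNReal.toReal_mono ENNReal.ofReal_ne_top hδ
    rwa [ENNReal.toReal_ofReal hA] at this
  have h := AdditiveFunctional.abs_coeff_mul_pow_le (P := P - C (F 0)) (n := ⌊K⌋₊) (M := M) (B := 2 * A)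
    ?_ hM ?_ k
  · rw [coeff_sub, coeff_C, if_neg hk, sub_zero] at h
    refine h.trans ?_
    gcongr
    exact Nat.floor_le hK
  · refine (natDegree_sub_C).trans_le ?_
    exact Nat.le_floor hP.1
  · intro x hx
    have h1 := hP.abs_sub_eval_le hfin hx
    have h2 := (enorm_le_supNorm (fun x => F x - F 0) hx).trans hF
    rw [Real.enorm_eq_ofReal_abs, ENNReal.ofReal_le_ofReal_iff hA] at h2
    rw [eval_sub, eval_C]
    calc _ = |(F x - F 0) - (F x - P.eval x)| := by ring_nf
      _ ≤ _ := abs_sub_le_abs_add_abs _ _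
      _ ≤ 2 * A := by linarith

/-- The second moment of the estimator `P̂_{K,M}` in terms of the approximation rate. -/
theorem integral_hermiteEstimate_sq_le_approxRate {F : ℝ → ℝ} {d : ℕ} {s ε₁ ε₂ C₁ C₂ c M R μ : ℝ}
    {P : ℝ[X]} (h1 : AssumptionA1 F d s ε₁ C₁) (h2 : AssumptionA2 F d s ε₂ C₂) (hC₁ : 0 < C₁)
    (hC₂ : 0 < C₂) (hc : 0 < c) (hc1 : c ≤ 1) (hM0 : 0 < M)
    (hM : M ∈ Set.Icc (√(2 * log (s ^ 2 / d))) (√(2 * log d)))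
    (hP : IsBestApprox F (c / 8 * M ^ 2) M P) (hMR : M ≤ R) (hμ : |μ| ≤ R) :
    ∫ x, hermiteEstimate (c / 8 * M ^ 2) P x ^ 2 ∂gaussianReal μ 1 ≤
      8 * (C₁ * C₂ * (approxRate F (c / 8 * M ^ 2) M).toReal) ^ 2 *
        exp (2 * (ε₁ + ε₂) * M ^ 2 + 2 * c * R ^ 2) := by
  set K := c / 8 * M ^ 2 with hKdef
  have hK : 0 ≤ K := by positivity
  have hKM : K ≤ M ^ 2 := by nlinarith [sq_nonneg M]
  have hA : 0 ≤ C₁ * exp (ε₁ * M ^ 2) := by positivity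
  have hfin : approxRate F K M ≠ ∞ :=
    ne_top_of_le_ne_top ENNReal.ofReal_ne_top (h1.approxRate_le hC₁.le hM hK)
  have hδ := h2.one_le_mul_approxRate hC₂.le hM hKM hfin
  set δ := (approxRate F K M).toReal
  have hcoef := fun k hk => hP.abs_coeff_mul_pow_le hM0 hA (h1.supNorm_le hC₁.le hM) (k := k) hk
  refine (integral_hermiteEstimate_sq_le hM0 hK hKM (by positivity) hcoef μ).trans ?_
  have hMR2 : M ^ 2 ≤ R ^ 2 := by gcongr
  have hMμ : M * |μ| ≤ R ^ 2 := by
    rw [sq]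
    exact mul_le_mul hMR hμ (abs_nonneg _) (hM0.le.trans hMR)
  -- Of the `10K`, `8K` comes from squaring `e^{4K}`. The three terms contribute at most `5/4`,
  -- `1/4` and `1/32` times `cR²`.
  have hexp : 10 * K + 2 * K / M * |μ| + (2 * K / M) ^ 2 / 2 ≤ 2 * c * R ^ 2 := by
    have e1 : 2 * K / M = c / 4 * M := by
      rw [hKdef]
      field_simp
      ring
    have e2 : 10 * K ≤ 10 / 8 * c * R ^ 2 := by
      rw [hKdef]
      nlinarith
    have e3 : c / 4 * (M * |μ|) ≤ c / 4 * R ^ 2 := by gcongr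
    have e4 : c ^ 2 * M ^ 2 ≤ c * R ^ 2 := by
      have : c ^ 2 ≤ c := by nlinarith
      gcongr
    have e5 : 0 ≤ c * R ^ 2 := by positivity
    rw [e1]
    nlinarith
  -- Multiplying by this square, which is at least `1`, introduces the factor `δ²`.
  have hδ2 : 1 ≤ (C₂ * exp (ε₂ * M ^ 2) * δ) ^ 2 := one_le_pow₀ hδ
  calc 2 * (2 * (C₁ * exp (ε₁ * M ^ 2)) * exp (4 * K)) ^ 2 *
        exp (2 * K + 2 * K / M * |μ| + (2 * K / M) ^ 2 / 2)
      = 8 * C₁ ^ 2 * exp (ε₁ * M ^ 2) ^ 2 *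
          (exp (4 * K) ^ 2 * exp (2 * K + 2 * K / M * |μ| + (2 * K / M) ^ 2 / 2)) := by ring
    _ = 8 * C₁ ^ 2 * exp (ε₁ * M ^ 2) ^ 2 *
          exp (10 * K + 2 * K / M * |μ| + (2 * K / M) ^ 2 / 2) := by
        congr 1
        rw [← exp_nat_mul, ← exp_add]
        push_cast
        ring_nf
    _ ≤ 8 * C₁ ^ 2 * exp (ε₁ * M ^ 2) ^ 2 * exp (2 * c * R ^ 2) := by gcongr
    _ ≤ 8 * C₁ ^ 2 * exp (ε₁ * M ^ 2) ^ 2 * exp (2 * c * R ^ 2) *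
          (C₂ * exp (ε₂ * M ^ 2) * δ) ^ 2 := le_mul_of_one_le_right (by positivity) hδ2
    _ = 8 * (C₁ * C₂ * δ) ^ 2 *
          (exp (ε₁ * M ^ 2) ^ 2 * exp (ε₂ * M ^ 2) ^ 2 * exp (2 * c * R ^ 2)) := by ring
    _ = _ := by
        congr 1
        rw [← exp_nat_mul, ← exp_nat_mul, ← exp_add, ← exp_add]
        push_cast
        ring_nf

/-! ### Moments of the coordinate estimator -/

theorem sq_integral_le_integral_sq {Ω : Type*} [MeasurableSpace Ω] {μ : Measure Ω}
    [IsProbabilityMeasure μ] {f : Ω → ℝ} (hf : MemLp f 2 μ) :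
    (∫ x, f x ∂μ) ^ 2 ≤ ∫ x, f x ^ 2 ∂μ := by
  have h := variance_nonneg f μ
  rw [variance_eq_sub hf] at h
  simpa using h

theorem memLp_hermiteEstimate_mul_scaleWeight (d : ℕ) (s K : ℝ) (P : ℝ[X]) (l : ℕ)
    (μ : ℝ) : MemLp (fun z : ℝ × ℝ => hermiteEstimate K P z.1 * scaleWeight d s l z.2) 2
      ((gaussianReal μ 1).prod (gaussianReal μ 1)) := by
  have hm : Measurable fun z : ℝ × ℝ => hermiteEstimate K P z.1 * scaleWeight d s l z.2 :=
    ((measurable_hermiteEstimate K P).comp measurable_fst).mul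
      ((measurable_scaleWeight d s l).comp measurable_snd)
  rw [memLp_two_iff_integrable_sq hm.aestronglyMeasurable]
  simp_rw [mul_pow, scaleWeight_sq]
  exact (integrable_hermiteEstimate_sq K P μ).mul_prod (integrable_scaleWeight d s l μ)

theorem memLp_coordEstimator (c : ℝ) (d : ℕ) (s : ℝ) (P : ℕ → ℝ[X]) (μ : ℝ) :
    MemLp (fun z : ℝ × ℝ => coordEstimator c d s P z.1 z.2) 2
      ((gaussianReal μ 1).prod (gaussianReal μ 1)) := by
  simp_rw [coordEstimator_eq_sum]
  exact memLp_finsetSum _ fun l _ => memLp_hermiteEstimate_mul_scaleWeight d s _ _ l μ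

theorem integral_coordEstimator {c : ℝ} {d : ℕ} {s : ℝ} {P : ℕ → ℝ[X]}
    (hP : ∀ l ≤ lastIndex d s, ((P l).natDegree : ℝ) ≤ deg c d s l) (μ : ℝ) :
    ∫ z, coordEstimator c d s P z.1 z.2 ∂(gaussianReal μ 1).prod (gaussianReal μ 1) =
      ∑ l ∈ Finset.range (lastIndex d s + 1),
        scaleProb d s l μ * ((P l).eval μ - (P l).eval 0) := by
  simp_rw [coordEstimator_eq_sum]
  rw [integral_finsetSum _ fun l _ =>
    (memLp_hermiteEstimate_mul_scaleWeight d s _ _ l μ).integrable one_le_two]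
  refine Finset.sum_congr rfl fun l hl => ?_
  rw [integral_prod_mul (hermiteEstimate (deg c d s l) (P l)) (scaleWeight d s l),
    integral_hermiteEstimate (hP l (by simpa [Nat.lt_succ_iff] using hl)), mul_comm]
  rfl

/-- Cauchy–Schwarz with weights of sum at most `1` removes the cross terms; independence of `u` and
`v` then factors each expectation. -/
theorem integral_coordEstimator_sq_le {c : ℝ} {d : ℕ} {s : ℝ} (hd : 1 ≤ d) (hs : 2 * √d ≤ s)
    (hsd : s ≤ d) (P : ℕ → ℝ[X]) (μ : ℝ) :
    ∫ z, coordEstimator c d s P z.1 z.2 ^ 2 ∂(gaussianReal μ 1).prod (gaussianReal μ 1) ≤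
      ∑ l ∈ Finset.range (lastIndex d s + 1), scaleProb d s l μ *
        ∫ x, hermiteEstimate (deg c d s l) (P l) x ^ 2 ∂gaussianReal μ 1 := by
  have hint : ∀ l, Integrable (fun z : ℝ × ℝ => hermiteEstimate (deg c d s l) (P l) z.1 ^ 2 *
      scaleWeight d s l z.2) ((gaussianReal μ 1).prod (gaussianReal μ 1)) := fun l =>
    (integrable_hermiteEstimate_sq _ _ μ).mul_prod (integrable_scaleWeight d s l μ)
  calc _ ≤ ∫ z, ∑ l ∈ Finset.range (lastIndex d s + 1),
          hermiteEstimate (deg c d s l) (P l) z.1 ^ 2 * scaleWeight d s l z.2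
          ∂(gaussianReal μ 1).prod (gaussianReal μ 1) := by
        refine integral_mono (memLp_coordEstimator c d s P μ).integrable_sq
          (integrable_finsetSum _ fun l _ => hint l) fun z => ?_
        dsimp only
        rw [coordEstimator_eq_sum]
        have h := Finset.sum_mul_sq_le_sq_mul_sq (Finset.range (lastIndex d s + 1))
          (fun l => hermiteEstimate (deg c d s l) (P l) z.1 * scaleWeight d s l z.2)
          (fun l => scaleWeight d s l z.2)
        simp only [mul_pow, scaleWeight_sq, mul_assoc, ← sq] at h
        refine h.trans (mul_le_of_le_one_right ?_ (sum_scaleWeight_le_one hd hs hsd _))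
        exact Finset.sum_nonneg fun l _ => mul_nonneg (sq_nonneg _) (scaleWeight_nonneg ..)
    _ = _ := by
        rw [integral_finsetSum _ fun l _ => hint l]
        refine Finset.sum_congr rfl fun l _ => ?_
        rw [integral_prod_mul (fun x => hermiteEstimate (deg c d s l) (P l) x ^ 2)
          (scaleWeight d s l), mul_comm]
        rfl

/-! ### Variance and bias of one coordinate -/

/-- The properties of the approximating polynomials on which the risk bound rests: `D` bounds the
approximation errors, and the polynomials and `F` grow at most like `κ D` times a slowly increasing
Gaussian factor. -/
structure ControlledApprox (F : ℝ → ℝ) (c : ℝ) (d : ℕ) (s : ℝ) (P : ℕ → ℝ[X])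
    (κ D a₁ a₂ : ℝ) : Prop where
  kappa_nonneg : 0 ≤ κ
  rate_nonneg : 0 ≤ D
  exponent_nonneg : 0 ≤ a₁
  exponent_nonneg' : 0 ≤ a₂
  exponent_le : a₁ + a₂ ≤ 1 / 64
  natDegree_le : ∀ l ≤ lastIndex d s, ((P l).natDegree : ℝ) ≤ deg c d s l
  second_moment_le : ∀ l ≤ lastIndex d s, ∀ μ R : ℝ, scale d s l ≤ R → |μ| ≤ R →
    ∫ x, hermiteEstimate (deg c d s l) (P l) x ^ 2 ∂gaussianReal μ 1 ≤
      8 * (κ * D) ^ 2 * exp (a₁ * scale d s l ^ 2 + a₂ * R ^ 2)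
  abs_sub_le : ∀ l ≤ lastIndex d s, ∀ x, |x| ≤ scale d s l → |F x - (P l).eval x| ≤ D
  growth_le : ∀ l ≤ lastIndex d s, ∀ x, scale d s l ≤ |x| → |x| ≤ √(2 * log d) →
    |F x - F 0| ≤ κ * D * exp (a₁ / 2 * x ^ 2)

variable {F : ℝ → ℝ} {c : ℝ} {d : ℕ} {s : ℝ} {P : ℕ → ℝ[X]} {κ D a₁ a₂ : ℝ}

/-- The moment bound is used with `R = M_l`. At level `0` the factor `e^{M_0²/64}` is at most
`s²/d`; at higher levels the probability `2e^{-M_l²/32}` leaves `2e^{-M_l²/64}`. The sum gives `258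
= 2(2·64 + 1)`. -/
theorem ControlledApprox.integral_sq_zero_le (h : ControlledApprox F c d s P κ D a₁ a₂)
    (hd : 1 ≤ d) (hs : 2 * √d ≤ s) (hsd : s ≤ d) :
    ∫ z, coordEstimator c d s P z.1 z.2 ^ 2 ∂(gaussianReal 0 1).prod (gaussianReal 0 1) ≤
      8 * (κ * D) ^ 2 * (s ^ 2 / d + 258) := by
  have h4 := four_le_sq_div hd hs
  have hterm : ∀ l ∈ Finset.range (lastIndex d s + 1),
      scaleProb d s l 0 * ∫ x, hermiteEstimate (deg c d s l) (P l) x ^ 2 ∂gaussianReal 0 1 ≤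
        8 * (κ * D) ^ 2 * ((if l = 0 then s ^ 2 / d else 0) +
          2 * exp (-(1 / 64 * scale d s l ^ 2))) := by
    intro l hl
    have hlN : l ≤ lastIndex d s := by simpa [Nat.lt_succ_iff] using hl
    have hM := one_le_scale hd hs hsd l
    have hp := scaleProb_nonneg d s l 0
    have hm := h.second_moment_le l hlN 0 (scale d s l) le_rfl (by simp; linarith)
    have hexp : exp (a₁ * scale d s l ^ 2 + a₂ * scale d s l ^ 2) ≤
        exp (1 / 64 * scale d s l ^ 2) := by
      rw [← add_mul]
      gcongr
      exact h.exponent_le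
    have key : scaleProb d s l 0 * exp (1 / 64 * scale d s l ^ 2) ≤
        (if l = 0 then s ^ 2 / d else 0) + 2 * exp (-(1 / 64 * scale d s l ^ 2)) := by
      cases l with
      | zero =>
        have h1 : exp (1 / 64 * scale d s 0 ^ 2) ≤ s ^ 2 / d := by
          have hlog := one_le_log_sq_div hd hs
          rw [scale_zero hd hs hsd, sq_sqrt (by linarith)]
          calc _ ≤ exp (log (s ^ 2 / d)) := exp_le_exp.2 (by linarith)
            _ = _ := exp_log (by linarith)
        have h2 := mul_le_mul (scaleProb_le_one hd hs hsd hl 0) h1 (exp_pos _).le zero_le_one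
        have h3 := exp_pos (-(1 / 64 * scale d s 0 ^ 2))
        simp only [if_true]
        linarith
      | succ l =>
        have h1 := scaleProb_succ_zero_le hd hs hsd (Nat.lt_of_succ_le hlN)
        simp only [Nat.add_eq_zero_iff, one_ne_zero, and_false, if_false, zero_add]
        calc _ ≤ 2 * exp (-(1 / 32 * scale d s (l + 1) ^ 2)) *
              exp (1 / 64 * scale d s (l + 1) ^ 2) := by gcongr
          _ = _ := by
              rw [mul_assoc, ← exp_add]
              ring_nf
    calc _ ≤ scaleProb d s l 0 * (8 * (κ * D) ^ 2 * exp (1 / 64 * scale d s l ^ 2)) := by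
          gcongr
          exact hm.trans (by gcongr)
      _ = 8 * (κ * D) ^ 2 * (scaleProb d s l 0 * exp (1 / 64 * scale d s l ^ 2)) := by ring
      _ ≤ _ := by gcongr
  refine (integral_coordEstimator_sq_le hd hs hsd P 0).trans ((Finset.sum_le_sum hterm).trans ?_)
  rw [← Finset.mul_sum, Finset.sum_add_distrib, ← Finset.mul_sum]
  have h1 := sum_exp_neg_scale_sq_le hd hs (b := 1 / 64) (by norm_num)
  norm_num at h1 ⊢
  gcongr
  linarith

/-- With `R = √(2 log d)`, every level has exponential factor at most `e^{2 log d/64} ≤ √d`, and the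
level probabilities sum to `1`. -/
theorem ControlledApprox.integral_sq_le (h : ControlledApprox F c d s P κ D a₁ a₂)
    (hd : 1 ≤ d) (hs : 2 * √d ≤ s) (hsd : s ≤ d) {μ : ℝ} (hμ : |μ| ≤ √(2 * log d)) :
    ∫ z, coordEstimator c d s P z.1 z.2 ^ 2 ∂(gaussianReal μ 1).prod (gaussianReal μ 1) ≤
      8 * (κ * D) ^ 2 * √d := by
  have hd0 : (0 : ℝ) < d := by exact_mod_cast hd
  have hlog : 0 ≤ log d := log_natCast_nonneg d
  have hterm : ∀ l ∈ Finset.range (lastIndex d s + 1),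
      scaleProb d s l μ * ∫ x, hermiteEstimate (deg c d s l) (P l) x ^ 2 ∂gaussianReal μ 1 ≤
        scaleProb d s l μ * (8 * (κ * D) ^ 2 * √d) := by
    intro l hl
    have hlN : l ≤ lastIndex d s := by simpa [Nat.lt_succ_iff] using hl
    have hp := scaleProb_nonneg d s l μ
    have hM := (scale_mem_Icc hd hs hsd l).2
    have hM0 := one_le_scale hd hs hsd l
    have hm := h.second_moment_le l hlN μ _ hM hμ
    have hexp : exp (a₁ * scale d s l ^ 2 + a₂ * √(2 * log d) ^ 2) ≤ √d := by
      have h1 : scale d s l ^ 2 ≤ √(2 * log d) ^ 2 := by gcongr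
      rw [sq_sqrt (by linarith)] at h1 ⊢
      have h2 := mul_le_mul_of_nonneg_left h1 h.exponent_nonneg
      have h3 := mul_le_mul_of_nonneg_right h.exponent_le (by positivity : 0 ≤ 2 * log d)
      rw [show √(d : ℝ) = exp (log d / 2) by rw [← log_sqrt hd0.le, exp_log (by positivity)]]
      refine exp_le_exp.2 ?_
      nlinarith
    gcongr
    exact hm.trans (by gcongr)
  refine (integral_coordEstimator_sq_le hd hs hsd P μ).trans ((Finset.sum_le_sum hterm).trans ?_)
  rw [← Finset.sum_mul, sum_scaleProb hd hs hsd, one_mul]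

/-- Growth of `P_l` outside its interval: `P_l(μ) - P_l(0)` is the mean of the Hermite estimate, so
its square is at most the second moment, taken with `R = |μ|`. -/
theorem ControlledApprox.abs_eval_sub_le (h : ControlledApprox F c d s P κ D a₁ a₂)
    {l : ℕ} (hl : l ≤ lastIndex d s) {μ : ℝ} (hM : 0 ≤ scale d s l) (hμ : scale d s l ≤ |μ|) :
    |(P l).eval μ - (P l).eval 0| ≤ 3 * (κ * D) * exp (1 / 128 * μ ^ 2) := by
  have hκD := mul_nonneg h.kappa_nonneg h.rate_nonneg
  have hmem : MemLp (hermiteEstimate (deg c d s l) (P l)) 2 (gaussianReal μ 1) :=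
    (memLp_two_iff_integrable_sq (measurable_hermiteEstimate _ _).aestronglyMeasurable).2
      (integrable_hermiteEstimate_sq _ _ μ)
  have h1 := (sq_integral_le_integral_sq hmem).trans (h.second_moment_le l hl μ |μ| hμ le_rfl)
  rw [integral_hermiteEstimate (h.natDegree_le l hl)] at h1
  refine abs_le_of_sq_le_sq (h1.trans ?_) (by positivity)
  have h2 : scale d s l ^ 2 ≤ μ ^ 2 := by
    rw [← sq_abs μ]
    gcongr
  have h3 : a₁ * scale d s l ^ 2 + a₂ * |μ| ^ 2 ≤ 1 / 64 * μ ^ 2 := by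
    have := mul_le_mul_of_nonneg_left h2 h.exponent_nonneg
    have := mul_le_mul_of_nonneg_right h.exponent_le (sq_nonneg μ)
    rw [sq_abs]
    linarith
  calc _ ≤ 8 * (κ * D) ^ 2 * exp (1 / 64 * μ ^ 2) := by gcongr
    _ ≤ 9 * (κ * D) ^ 2 * exp (1 / 64 * μ ^ 2) := by gcongr; norm_num
    _ = 9 * (κ * D) ^ 2 * exp (1 / 128 * μ ^ 2) ^ 2 := by
        rw [← exp_nat_mul]
        push_cast
        ring_nf
    _ = _ := by ring

/-- The bias is the average over levels of the level errors. Levels with `M_l ≥ |μ|` contribute `2D`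
in all; the lower ones form a summable series, and `264 = 8(2·16 + 1)`. -/
theorem ControlledApprox.abs_bias_le (h : ControlledApprox F c d s P κ D a₁ a₂)
    (hd : 1 ≤ d) (hs : 2 * √d ≤ s) (hsd : s ≤ d) {μ : ℝ} (hμ : |μ| ≤ √(2 * log d)) :
    |∫ z, coordEstimator c d s P z.1 z.2 ∂(gaussianReal μ 1).prod (gaussianReal μ 1) -
      (F μ - F 0)| ≤ (2 + 264 * κ) * D := by
  have hκD := mul_nonneg h.kappa_nonneg h.rate_nonneg
  have hD := h.rate_nonneg
  have hterm : ∀ l ∈ Finset.range (lastIndex d s + 1),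
      |scaleProb d s l μ * ((P l).eval μ - (P l).eval 0 - (F μ - F 0))| ≤
        scaleProb d s l μ * (2 * D) + 8 * (κ * D) * exp (-(1 / 16 * scale d s l ^ 2)) := by
    intro l hl
    have hlN : l ≤ lastIndex d s := by simpa [Nat.lt_succ_iff] using hl
    have hp := scaleProb_nonneg d s l μ
    have hM0 := one_le_scale hd hs hsd l
    rw [abs_mul, abs_of_nonneg hp]
    rcases le_or_gt |μ| (scale d s l) with hle | hlt
    · have h1 := h.abs_sub_le l hlN μ hle
      have h2 := h.abs_sub_le l hlN 0 (by simp; linarith)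
      have h3 : |(P l).eval μ - (P l).eval 0 - (F μ - F 0)| ≤ 2 * D := by
        calc _ = |(F 0 - (P l).eval 0) - (F μ - (P l).eval μ)| := by ring_nf
          _ ≤ _ := abs_sub_le_abs_add_abs _ _
          _ ≤ _ := by linarith
      have h4 : 0 ≤ 8 * (κ * D) * exp (-(1 / 16 * scale d s l ^ 2)) := by positivity
      have h5 := mul_le_mul_of_nonneg_left h3 hp
      linarith
    -- The last scale is never exceeded by `|μ|`, so the selected level has an upper threshold.
    · have hlN' : l < lastIndex d s := by
        refine lt_of_le_of_ne hlN fun he => ?_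
        rw [he, scale_lastIndex] at hlt
        exact absurd hμ (not_le.2 hlt)
      have h1 := h.abs_eval_sub_le hlN (by linarith) hlt.le
      have h2 := h.growth_le l hlN μ hlt.le hμ
      have h3 : |F μ - F 0| ≤ κ * D * exp (1 / 128 * μ ^ 2) := by
        have ha : a₁ / 2 ≤ 1 / 128 := by linarith [h.exponent_le, h.exponent_nonneg']
        exact h2.trans (mul_le_mul_of_nonneg_left
          (exp_le_exp.2 (mul_le_mul_of_nonneg_right ha (sq_nonneg _))) hκD)
      have h4 : |(P l).eval μ - (P l).eval 0 - (F μ - F 0)| ≤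
          4 * (κ * D) * exp (1 / 128 * μ ^ 2) :=
        (abs_sub_le_abs_add_abs _ _).trans (by linarith)
      have h5 := scaleProb_le_of_scale_lt hlN' hlt
      have h6 : scale d s l ^ 2 ≤ μ ^ 2 := by
        rw [← sq_abs μ]
        gcongr
      have h7 : 0 ≤ scaleProb d s l μ * (2 * D) := by positivity
      calc _ ≤ 2 * exp (-(1 / 8 * μ ^ 2)) * (4 * (κ * D) * exp (1 / 128 * μ ^ 2)) := by gcongr
        _ = 8 * (κ * D) * exp (-(1 / 8 * μ ^ 2) + 1 / 128 * μ ^ 2) := by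
            rw [exp_add]
            ring
        _ ≤ 8 * (κ * D) * exp (-(1 / 16 * scale d s l ^ 2)) := by
            gcongr
            nlinarith
        _ ≤ _ := by linarith
  have heq : ∫ z, coordEstimator c d s P z.1 z.2 ∂(gaussianReal μ 1).prod (gaussianReal μ 1) -
      (F μ - F 0) = ∑ l ∈ Finset.range (lastIndex d s + 1),
        scaleProb d s l μ * ((P l).eval μ - (P l).eval 0 - (F μ - F 0)) := by
    rw [integral_coordEstimator h.natDegree_le]
    simp_rw [mul_sub (scaleProb d s _ μ) (_ - _) (F μ - F 0)]
    rw [Finset.sum_sub_distrib, ← Finset.sum_mul, sum_scaleProb hd hs hsd, one_mul]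
  rw [heq]
  refine (Finset.abs_sum_le_sum_abs _ _).trans ((Finset.sum_le_sum hterm).trans ?_)
  rw [Finset.sum_add_distrib, ← Finset.sum_mul, ← Finset.mul_sum, sum_scaleProb hd hs hsd]
  have h1 := sum_exp_neg_scale_sq_le hd hs (b := 1 / 16) (by norm_num)
  have h2 := mul_le_mul_of_nonneg_left h1 (by positivity : 0 ≤ 8 * (κ * D))
  norm_num at h2 ⊢
  linarith

theorem ControlledApprox.integral_zero (h : ControlledApprox F c d s P κ D a₁ a₂) :
    ∫ z, coordEstimator c d s P z.1 z.2 ∂(gaussianReal 0 1).prod (gaussianReal 0 1) = 0 := by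
  rw [integral_coordEstimator h.natDegree_le]
  simp

/-! ### Bias–variance decomposition of the risk -/

/-- The contribution of one coordinate with mean `μ` to the error of the estimator. -/
noncomputable def coordError (F : ℝ → ℝ) (c : ℝ) (d : ℕ) (s : ℝ) (P : ℕ → ℝ[X]) (μ : ℝ)
    (z : ℝ × ℝ) : ℝ :=
  coordEstimator c d s P z.1 z.2 - (F μ - F 0)

theorem memLp_coordError (F : ℝ → ℝ) (c : ℝ) (d : ℕ) (s : ℝ) (P : ℕ → ℝ[X]) (μ : ℝ) :
    MemLp (coordError F c d s P μ) 2 ((gaussianReal μ 1).prod (gaussianReal μ 1)) :=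
  (memLp_coordEstimator c d s P μ).sub (memLp_const _)

theorem integral_coordError (F : ℝ → ℝ) (c : ℝ) (d : ℕ) (s : ℝ) (P : ℕ → ℝ[X]) (μ : ℝ) :
    ∫ z, coordError F c d s P μ z ∂(gaussianReal μ 1).prod (gaussianReal μ 1) =
      ∫ z, coordEstimator c d s P z.1 z.2 ∂(gaussianReal μ 1).prod (gaussianReal μ 1) -
        (F μ - F 0) := by
  simp only [coordError]
  rw [integral_sub ((memLp_coordEstimator c d s P μ).integrable one_le_two)
    (integrable_const _)]
  simp

theorem variance_coordError_le (F : ℝ → ℝ) (c : ℝ) (d : ℕ) (s : ℝ) (P : ℕ → ℝ[X]) (μ : ℝ) :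
    Var[coordError F c d s P μ; (gaussianReal μ 1).prod (gaussianReal μ 1)] ≤
      ∫ z, coordEstimator c d s P z.1 z.2 ^ 2 ∂(gaussianReal μ 1).prod (gaussianReal μ 1) := by
  have hm := memLp_coordEstimator c d s P μ
  unfold coordError
  rw [variance_sub_const hm.aestronglyMeasurable]
  exact variance_le_expectation_sq hm.aestronglyMeasurable

/-- Regrouping the two samples into `d` independent pairs turns the error into a sum of independent
terms, whose variances add. -/
theorem quadRisk_estimator_eq (F : ℝ → ℝ) (c : ℝ) (s : ℝ) (P : ℕ → ℝ[X]) (θ : Fin d → ℝ) :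
    quadRisk F (estimator F c s P) θ = ENNReal.ofReal
      (∑ i, Var[coordError F c d s P (θ i); (gaussianReal (θ i) 1).prod (gaussianReal (θ i) 1)] +
        (∑ i, ∫ z, coordError F c d s P (θ i) z
          ∂(gaussianReal (θ i) 1).prod (gaussianReal (θ i) 1)) ^ 2) := by
  let ν : Fin d → Measure (ℝ × ℝ) := fun i => (gaussianReal (θ i) 1).prod (gaussianReal (θ i) 1)
  let e := MeasurableEquiv.arrowProdEquivProdArrow ℝ ℝ (Fin d)
  have he : MeasurePreserving e (Measure.pi ν) (sampleLaw θ) :=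
    measurePreserving_arrowProdEquivProdArrow ℝ ℝ (Fin d) _ _
  let T : (Fin d → ℝ × ℝ) → ℝ := ∑ i, fun ω => coordError F c d s P (θ i) (ω i)
  have hTe : ∀ ω, estimator F c s P (e ω) - ∑ i, F (θ i) = T ω := by
    intro ω
    simp only [T, Finset.sum_apply, coordError, Finset.sum_sub_distrib, Finset.sum_const,
      Finset.card_univ, Fintype.card_fin, nsmul_eq_mul, estimator]
    change _ + ∑ i, coordEstimator c d s P (ω i).1 (ω i).2 - _ = _
    ring
  have hmem : ∀ i, MemLp (fun ω : Fin d → ℝ × ℝ => coordError F c d s P (θ i) (ω i)) 2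
      (Measure.pi ν) := fun i =>
    (memLp_coordError F c d s P (θ i)).comp_measurePreserving (measurePreserving_eval ν i)
  have hT : MemLp T 2 (Measure.pi ν) := memLp_finsetSum' _ fun i _ => hmem i
  have hvar : Var[T; Measure.pi ν] = ∑ i, Var[coordError F c d s P (θ i); ν i] :=
    variance_sum_pi fun i => memLp_coordError F c d s P (θ i)
  have hmean : ∫ ω, T ω ∂Measure.pi ν = ∑ i, ∫ z, coordError F c d s P (θ i) z ∂ν i := by
    simp only [T, Finset.sum_apply]
    rw [integral_finsetSum _ fun i _ => (hmem i).integrable one_le_two]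
    refine Finset.sum_congr rfl fun i _ => ?_
    have hmp := measurePreserving_eval ν i
    have := integral_map hmp.measurable.aemeasurable
      (by rw [hmp.map_eq]; exact (memLp_coordError F c d s P (θ i)).aestronglyMeasurable)
    rw [hmp.map_eq] at this
    exact this.symm
  rw [← hvar, ← hmean, variance_eq_sub hT, sub_add_cancel, quadRisk,
    ← he.lintegral_comp_emb e.measurableEmbedding]
  simp_rw [hTe]
  rw [← ofReal_integral_eq_lintegral_ofReal hT.integrable_sq (ae_of_all _ fun ω => sq_nonneg _)]
  rfl

theorem ControlledApprox.quadRisk_le (h : ControlledApprox F c d s P κ D a₁ a₂)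
    (hd : 1 ≤ d) (hs : 2 * √d ≤ s) (hsd : s ≤ d) {θ : Fin d → ℝ}
    (hθ : θ ∈ paramSet d s (√(2 * log d))) :
    quadRisk F (estimator F c s P) θ ≤
      ENNReal.ofReal ((528 * κ ^ 2 + (2 + 264 * κ) ^ 2) * s ^ 2 * D ^ 2) := by
  have hd0 : (0 : ℝ) < d := by exact_mod_cast hd
  have hκ := h.kappa_nonneg
  have hD := h.rate_nonneg
  have hs0 : 0 ≤ s := le_trans (by positivity) hs
  obtain ⟨hcard, hbd⟩ := hθ
  have hcard' : ∑ i, (if θ i ≠ 0 then (1 : ℝ) else 0) ≤ s := by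
    refine le_of_eq_of_le ?_ hcard
    rw [Finset.sum_boole]
    rfl
  rw [quadRisk_estimator_eq]
  refine ENNReal.ofReal_le_ofReal ?_
  have hvar : ∀ i, Var[coordError F c d s P (θ i);
      (gaussianReal (θ i) 1).prod (gaussianReal (θ i) 1)] ≤
        8 * (κ * D) ^ 2 * (s ^ 2 / d + 258) +
          (if θ i ≠ 0 then 1 else 0) * (8 * (κ * D) ^ 2 * √d) := by
    intro i
    refine (variance_coordError_le ..).trans ?_
    by_cases h0 : θ i = 0
    · simpa [h0] using h.integral_sq_zero_le hd hs hsd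
    · have h1 := h.integral_sq_le hd hs hsd (hbd i)
      have h2 : 0 ≤ 8 * (κ * D) ^ 2 * (s ^ 2 / d + 258) := by positivity
      rw [if_pos h0]
      linarith
  have hbias : ∀ i, |∫ z, coordError F c d s P (θ i) z
      ∂(gaussianReal (θ i) 1).prod (gaussianReal (θ i) 1)| ≤
        (if θ i ≠ 0 then 1 else 0) * ((2 + 264 * κ) * D) := by
    intro i
    rw [integral_coordError]
    by_cases h0 : θ i = 0
    · simp [h0, h.integral_zero]
    · simpa [h0] using h.abs_bias_le hd hs hsd (hbd i)
  have hsumvar := Finset.sum_le_sum fun i (_ : i ∈ Finset.univ) => hvar i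
  rw [Finset.sum_add_distrib, Finset.sum_const, Finset.card_univ, Fintype.card_fin,
    nsmul_eq_mul, ← Finset.sum_mul] at hsumvar
  have hsumbias := (Finset.abs_sum_le_sum_abs _ _).trans
    (Finset.sum_le_sum fun i (_ : i ∈ Finset.univ) => hbias i)
  rw [← Finset.sum_mul] at hsumbias
  have hsumbias' := hsumbias.trans
    (mul_le_mul_of_nonneg_right hcard' (by positivity : 0 ≤ (2 + 264 * κ) * D))
  have hsq := sq_le_sq' (neg_le_of_abs_le hsumbias') (le_of_abs_le hsumbias')
  have hcard2 := mul_le_mul_of_nonneg_right hcard' (by positivity : 0 ≤ 8 * (κ * D) ^ 2 * √d)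
  have hds : 4 * (d : ℝ) ≤ s ^ 2 := by
    have := four_le_sq_div hd hs
    rwa [le_div_iff₀ hd0] at this
  have hsd2 : s * √d ≤ s ^ 2 / 2 := by nlinarith
  -- From `d ≤ s²/4` and `s√d ≤ s²/2`: `1 + 258/4 + 1/2 = 66`, and `528 = 8·66`.
  have hmain : (d : ℝ) * (8 * (κ * D) ^ 2 * (s ^ 2 / d + 258)) + s * (8 * (κ * D) ^ 2 * √d) ≤
      528 * κ ^ 2 * s ^ 2 * D ^ 2 := by
    have e1 : (d : ℝ) * (8 * (κ * D) ^ 2 * (s ^ 2 / d + 258)) =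
        8 * (κ * D) ^ 2 * (s ^ 2 + 258 * d) := by
      field_simp
    calc _ = 8 * (κ * D) ^ 2 * (s ^ 2 + 258 * d + s * √d) := by rw [e1]; ring
      _ ≤ 8 * (κ * D) ^ 2 * (66 * s ^ 2) := by
          gcongr
          linarith
      _ = _ := by ring
  calc _ ≤ 528 * κ ^ 2 * s ^ 2 * D ^ 2 + (s * ((2 + 264 * κ) * D)) ^ 2 := by linarith
    _ = _ := by ring

/-! ### From the assumptions to the theorem -/

theorem controlledApprox_of_assumptions {ε₁ ε₂ C₁ C₂ : ℝ} (hε₁ : 0 < ε₁) (hε₂ : 0 < ε₂)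
    (hε : ε₁ + ε₂ < 1 / 256) (hc : 0 < c) (hc1 : c ≤ 1 / 256) (hC₁ : 0 < C₁) (hC₂ : 0 < C₂)
    (hd : 1 ≤ d) (hs : 2 * √d ≤ s) (hsd : s ≤ d)
    (h1 : AssumptionA1 F d s ε₁ C₁) (h2 : AssumptionA2 F d s ε₂ C₂)
    (hP : ∀ l ≤ lastIndex d s, IsBestApprox F (deg c d s l) (scale d s l) (P l))
    (hD : 0 ≤ D) (hDrate : ∀ l ≤ lastIndex d s,
      (approxRate F (deg c d s l) (scale d s l)).toReal ≤ D) :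
    ControlledApprox F c d s P (C₁ * C₂) D (2 * (ε₁ + ε₂)) (2 * c) := by
  have hM := scale_mem_Icc hd hs hsd
  have hM1 := one_le_scale hd hs hsd
  have hdeg0 : ∀ l, 0 ≤ deg c d s l := fun l => by
    rw [deg]
    positivity
  have hdeg : ∀ l, deg c d s l ≤ scale d s l ^ 2 := fun l => by
    rw [deg]
    nlinarith [sq_nonneg (scale d s l)]
  have hfin : ∀ l, approxRate F (deg c d s l) (scale d s l) ≠ ∞ := fun l =>
    ne_top_of_le_ne_top ENNReal.ofReal_ne_top (h1.approxRate_le hC₁.le (hM l) (hdeg0 l))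
  refine ⟨by positivity, hD, by positivity, by positivity, by linarith, fun l hl => (hP l hl).1,
    ?_, ?_, ?_⟩
  · intro l hl μ R hR hμ
    refine (integral_hermiteEstimate_sq_le_approxRate h1 h2 hC₁ hC₂ hc (by linarith)
      (by linarith [hM1 l]) (hM l) (hP l hl) hR hμ).trans ?_
    have := hDrate l hl
    rw [deg] at this
    gcongr
  · intro l hl x hx
    exact ((hP l hl).abs_sub_eval_le (hfin l) hx).trans (hDrate l hl)
  · intro l hl x hx hx'
    -- (A1) is applied at the scale `|x|` itself, (A2) at the smaller scale `M_l`.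
    have hxM : |x| ∈ Set.Icc (√(2 * log (s ^ 2 / d))) (√(2 * log d)) :=
      ⟨(hM l).1.trans hx, hx'⟩
    have hF := h1.abs_sub_le hC₁.le hxM le_rfl
    have hδ := h2.one_le_mul_approxRate hC₂.le (hM l) (hdeg l) (hfin l)
    have hδ' : 1 ≤ C₂ * exp (ε₂ * x ^ 2) * D := by
      refine hδ.trans ?_
      have hsq : scale d s l ^ 2 ≤ x ^ 2 := by
        rw [← sq_abs x]
        have := hM1 l
        gcongr
      have := hDrate l hl
      gcongr
    calc _ ≤ C₁ * exp (ε₁ * x ^ 2) := by rwa [sq_abs] at hF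
      _ ≤ C₁ * exp (ε₁ * x ^ 2) * (C₂ * exp (ε₂ * x ^ 2) * D) :=
          le_mul_of_one_le_right (by positivity) hδ'
      _ = C₁ * C₂ * D * (exp (ε₁ * x ^ 2) * exp (ε₂ * x ^ 2)) := by ring
      _ = _ := by
          rw [← exp_add]
          ring_nf

end AdditiveFunctional

theorem theorem1 :
    ∃ η : ℝ, 0 < η ∧ ∃ c₀ : ℝ → ℝ → ℝ, (∀ ε₁ ε₂, 0 < ε₁ → 0 < ε₂ → 0 < c₀ ε₁ ε₂) ∧
      ∀ C₁ C₂ : ℝ, 0 < C₁ → 0 < C₂ → ∃ C₃ : ℝ, 0 < C₃ ∧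
        ∀ ε₁ ε₂ : ℝ, 0 < ε₁ → 0 < ε₂ → ε₁ + ε₂ < η →
        ∀ c : ℝ, 0 < c → c ≤ c₀ ε₁ ε₂ →
        ∀ (d : ℕ) (s : ℝ), 1 ≤ d → 2 * √d ≤ s → s ≤ d →
        ∀ F : ℝ → ℝ, AssumptionA1 F d s ε₁ C₁ → AssumptionA2 F d s ε₂ C₂ →
        ∀ P : ℕ → ℝ[X],
          (∀ l ≤ lastIndex d s, IsBestApprox F (deg c d s l) (scale d s l) (P l)) →
          (⨆ θ ∈ paramSet d s (√(2 * log d)), quadRisk F (estimator F c s P) θ) ≤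
            ENNReal.ofReal C₃ * ENNReal.ofReal s ^ 2 *
              (Finset.range (lastIndex d s + 1)).sup
                (fun l => approxRate F (deg c d s l) (scale d s l) ^ 2) := by
  -- With both constants `1/256`, the exponents satisfy `2(ε₁ + ε₂) + 2c ≤ 1/64`.
  refine ⟨1 / 256, by norm_num, fun _ _ => 1 / 256, fun _ _ _ _ => by norm_num, ?_⟩
  intro C₁ C₂ hC₁ hC₂
  refine ⟨528 * (C₁ * C₂) ^ 2 + (2 + 264 * (C₁ * C₂)) ^ 2, by positivity, ?_⟩
  intro ε₁ ε₂ hε₁ hε₂ hε c hc hc1 d s hd hs hsd F h1 h2 P hP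
  set S := (Finset.range (lastIndex d s + 1)).sup
    (fun l => approxRate F (deg c d s l) (scale d s l) ^ 2)
  -- Finiteness, from (A1), allows passing to real numbers with `D = √S` without loss.
  have hS : S ≠ ∞ := by
    refine ne_of_lt ((Finset.sup_lt_iff ENNReal.zero_lt_top).2 fun l _ => ?_)
    refine (ENNReal.pow_ne_top (ne_top_of_le_ne_top ENNReal.ofReal_ne_top
      (h1.approxRate_le hC₁.le (scale_mem_Icc hd hs hsd l) ?_))).lt_top
    rw [deg]
    positivity
  have hrate : ∀ l ≤ lastIndex d s,
      (approxRate F (deg c d s l) (scale d s l)).toReal ≤ √S.toReal := by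
    intro l hl
    refine le_sqrt_of_sq_le ?_
    rw [← ENNReal.toReal_pow]
    exact ENNReal.toReal_mono hS (Finset.le_sup
      (f := fun l => approxRate F (deg c d s l) (scale d s l) ^ 2)
      (Finset.mem_range.2 (Nat.lt_succ_of_le hl)))
  have h := controlledApprox_of_assumptions hε₁ hε₂ hε hc hc1 hC₁ hC₂ hd hs hsd h1 h2 hP
    (sqrt_nonneg _) hrate
  refine iSup₂_le fun θ hθ => (h.quadRisk_le hd hs hsd hθ).trans_eq ?_
  have hs0 : 0 ≤ s := le_trans (by positivity) hs
  rw [sq_sqrt ENNReal.toReal_nonneg, ENNReal.ofReal_mul (by positivity),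
    ENNReal.ofReal_mul (by positivity), ENNReal.ofReal_toReal hS, ENNReal.ofReal_pow hs0]
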